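/- Fix $q\in(0,1)$, $z_+>0$, $z_-<0$, and let $\mathbb R_q=\{z_-q^n\mid n\in\mathbb Z\}\cup\{z_+q^n\mid n\in\mathbb Z\}$. Write $(x;q)_\infty=\prod_{k\ge 0}(1-xq^k)$, $(x;q)_n=\prod_{k=0}^{n-1}(1-xq^k)$ for $n\geq 0$, $(x_1,\dots,x_m;q)_n=\prod_j (x_j;q)_n$, and $\theta(x)=(x,q/x;q)_\infty$. Parameters. Let $P_{q,z_-,z_+}$ be the set of $(\alpha,\beta)\in\mathbb C^2$ with $\alpha,\beta\notin z_+^{-1}q^{\mathbb Z}\cup z_-^{-1}q^{\mathbb Z}$ such that one of the following holds: $\alpha=\overline\beta$; or $\alpha,\beta$ are real and $z_+q^{k_0}<\beta^{-1}<\alpha^{-1}<z_+q^{k_0-1}$ for some $k_0\in\mathbb Z$; or $\alpha,\beta$ are real and $z_-q^{k_0-1}<\alpha^{-1}<\beta^{-1}<z_-q^{k_0}$ for some $k_0\in\mathbb Z$. Let $a,b,c,d\in\mathbb C$ with $(a,b),(c,d)\in P_{q,z_-,z_+}$, $a\ne b$, $c\neq d$, and $c/a,\,c/b,\,d/a,\,d/b,\,cd/ab\notin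 q^{\mathbb Z}$. Put $s=\sqrt{cdq/ab}$ (principal branch) and $$A(x)=s^{-1}\Big(1-\frac q{ax}\Big)\Big(1-\frac q{bx}\Big),\quad B(x)=s\Big(1-\frac1{cx}\Big)\Big(1-\frac1{dx}\Big),\quad C(x)=s^{-1}+s-A(x)-B(x).$$ For $f:\mathbb R_q\to\mathbb C$ let $(Lf)(x)=A(x)f(x/q)+B(x)f(qx)+C(x)f(x)$ and $(D_qf)(x)=\dfrac{f(x)-f(qx)}{x(1-q)}$. Let $$w(x)=\frac{(ax,bx;q)_\infty}{(cx,dx;q)_\infty},\quad u(x)=(1-q)^2B(x)x^2w(x),\quad D(f,g)(x)=\big(f(x)g(qx)-f(qx)g(x)\big)\frac{u(x)}{(1-q)x}$$ ($D(f,g)$ is the Casorati determinant). For $\mu\in\mathbb C$ let $V_\mu$ be the space of $f:\mathbb R_q\to\mathbb C$ with $Lf=\mu f$ such that the limits $\lim_{k\to\infty}f(z_\pm q^k)$ exist and are equal to each other, and the limits $\lim_{k\to\infty}(D_qf)(z_\pm q^k)$ exist and are equal to each other. For $\gamma\in\mathbb C^*$ put $\mu(\gamma)=\gamma+\gamma^{-1}$.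 The big $q$-Jacobi function $\varphi_\gamma=\varphi_\gamma(\cdot\,;a,b,c,d|q):\mathbb R_q\to\mathbb C$ is given, for $|x|<1/|b|$, by $$\varphi_\gamma(x)=\sum_{k=0}^\infty\frac{(q/ax,\,s\gamma,\,s/\gamma;q)_k}{(q,\,cq/a,\,dq/a;q)_k}(bx)^k,$$ and is extended to all of $\mathbb R_q$ by means of the eigenvalue equation $Lf=\mu(\gamma)f$; that is, for $|x|\ge 1/|b|$ it is determined recursively by $A(qx)\varphi_\gamma(x)=(\mu(\gamma)-C(qx))\varphi_\gamma(qx)-B(qx)\varphi_\gamma(q^2x)$. Let $\varphi_\gamma^\dagger=\varphi_\gamma(\cdot\,;b,a,c,d|q)$. Then for all $\gamma\in\mathbb C^*$ and all $x\in\mathbb R_q$, $$D(\varphi_\gamma,\varphi_\gamma^\dagger)(x)=\frac{(1-q)q}{as}\,\frac{(s\gamma,s/\gamma;q)_\infty\,\theta(a/b)}{(cq/a,cq/b,dq/a,dq/b;q)_\infty}.$$ Moreover, if $\gamma\in\mathbb C^*$ does not belong to $\mathcal S_{\mathrm{pol}}=\{sq^k\mid k\in\mathbb Z_{\ge0}\}\cup\{s^{-1}q^{-k}\mid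 k\in\mathbb Z_{\ge0}\}$, then $\dim V_{\mu(\gamma)}=2$ and $\{\varphi_\gamma,\varphi_\gamma^\dagger\}$ is a linear basis of $V_{\mu(\gamma)}$. -/

import Mathlib

open Filter Topology

noncomputable section

namespace BigQJacobi

/-! ### `q`-shifted factorials, theta function, basic hypergeometric series -/

/-- `(x;q)_∞ = ∏_{k ≥ 0} (1 - x q^k)`. -/
def qPochInf (q : ℝ) (x : ℂ) : ℂ := ∏' k : ℕ, (1 - x * (q : ℂ) ^ k)

/-- `(x;q)_n = ∏_{k < n} (1 - x q^k)` for `n ≥ 0`. -/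
def qPoch (q : ℝ) (x : ℂ) (n : ℕ) : ℂ := ∏ k ∈ Finset.range n, (1 - x * (q : ℂ) ^ k)

/-- The normalized Jacobi theta function `θ(x) = (x, q/x; q)_∞`. -/
def theta (q : ℝ) (x : ℂ) : ℂ := qPochInf q x * qPochInf q ((q : ℂ) / x)

/-- The basic hypergeometric series `₃φ₂(x₁,x₂,x₃; y₁,y₂; q, z)`. -/
def phi32 (q : ℝ) (x₁ x₂ x₃ y₁ y₂ z : ℂ) : ℂ :=
  ∑' k : ℕ, (qPoch q x₁ k * qPoch q x₂ k * qPoch q x₃ k) /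
    (qPoch q (q : ℂ) k * qPoch q y₁ k * qPoch q y₂ k) * z ^ k

/-! ### The `q`-analogue of the real line -/

/-- The underlying set of `ℝ_q = {z₋ q^n} ∪ {z₊ q^n}`, `n ∈ ℤ`. -/
def RqSet (q zp zm : ℝ) : Set ℝ := {x | ∃ n : ℤ, x = zm * q ^ n ∨ x = zp * q ^ n}

/-- `ℝ_q` as a type; functions on it are `Rq q zp zm → ℂ`. -/
abbrev Rq (q zp zm : ℝ) : Type := RqSet q zp zm

theorem zpow_mul_mem (q : ℝ) (n : ℤ) : ∃ m : ℤ, q * q ^ n = q ^ m := by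
  by_cases h : q = 0
  · exact ⟨1, by simp [h]⟩
  · exact ⟨n + 1, by rw [zpow_add₀ h, zpow_one, mul_comm]⟩

theorem inv_zpow_mul_mem (q : ℝ) (n : ℤ) : ∃ m : ℤ, q⁻¹ * q ^ n = q ^ m := by
  by_cases h : q = 0
  · exact ⟨1, by simp [h]⟩
  · exact ⟨n - 1, by rw [zpow_sub₀ h, zpow_one, div_eq_mul_inv, mul_comm]⟩

/-- The map `x ↦ q x` on `ℝ_q`. -/
def shiftUp {q zp zm : ℝ} (x : Rq q zp zm) : Rq q zp zm :=
  ⟨q * x.1, by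
    obtain ⟨n, h⟩ := x.2
    obtain ⟨m, hm⟩ := zpow_mul_mem q n
    refine ⟨m, ?_⟩
    rw [← hm]
    rcases h with h | h
    · left; rw [h]; ring
    · right; rw [h]; ring⟩

/-- The map `x ↦ q⁻¹ x` on `ℝ_q`. -/
def shiftDown {q zp zm : ℝ} (x : Rq q zp zm) : Rq q zp zm :=
  ⟨q⁻¹ * x.1, by
    obtain ⟨n, h⟩ := x.2
    obtain ⟨m, hm⟩ := inv_zpow_mul_mem q n
    refine ⟨m, ?_⟩
    rw [← hm]
    rcases h with h | h
    · left; rw [h]; ring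
    · right; rw [h]; ring⟩

/-- The point `z₊ q^n` of `ℝ_q`. -/
def ptPlus (q zp zm : ℝ) (n : ℤ) : Rq q zp zm := ⟨zp * q ^ n, n, Or.inr rfl⟩

/-- The point `z₋ q^n` of `ℝ_q`. -/
def ptMinus (q zp zm : ℝ) (n : ℤ) : Rq q zp zm := ⟨zm * q ^ n, n, Or.inl rfl⟩

/-! ### Parameter domains -/

/-- The set `P_{q,z₋,z₊}` of pairs `(α, β)`. -/
def PairDomain (q zp zm : ℝ) : Set (ℂ × ℂ) :=
  {p | (∀ n : ℤ, p.1 ≠ ((zp⁻¹ * q ^ n : ℝ) : ℂ) ∧ p.1 ≠ ((zm⁻¹ * q ^ n : ℝ) : ℂ)) ∧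
    (∀ n : ℤ, p.2 ≠ ((zp⁻¹ * q ^ n : ℝ) : ℂ) ∧ p.2 ≠ ((zm⁻¹ * q ^ n : ℝ) : ℂ)) ∧
    (p.1 = (starRingEnd ℂ) p.2 ∨
      (∃ α β : ℝ, p.1 = (α : ℂ) ∧ p.2 = (β : ℂ) ∧
        ∃ k₀ : ℤ, zp * q ^ k₀ < β⁻¹ ∧ β⁻¹ < α⁻¹ ∧ α⁻¹ < zp * q ^ (k₀ - 1)) ∨
      (∃ α β : ℝ, p.1 = (α : ℂ) ∧ p.2 = (β : ℂ) ∧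
        ∃ k₀ : ℤ, zm * q ^ (k₀ - 1) < α⁻¹ ∧ α⁻¹ < β⁻¹ ∧ β⁻¹ < zm * q ^ k₀))}

/-- The parameter domain `P`. -/
def ParamDomain (q zp zm : ℝ) : Set (ℂ × ℂ × ℂ × ℂ) :=
  {p | ∃ a b c d : ℂ, p = (a, b, c, d) ∧
    (a, b) ∈ PairDomain q zp zm ∧ (c, d) ∈ PairDomain q zp zm ∧ a ≠ b}

/-- The set of generic parameters `P_gen`. -/
def GenericDomain (q zp zm : ℝ) : Set (ℂ × ℂ × ℂ × ℂ) :=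
  {p | ∃ a b c d : ℂ, p = (a, b, c, d) ∧ (a, b, c, d) ∈ ParamDomain q zp zm ∧ c ≠ d ∧
    ∀ n : ℤ, c / a ≠ (q : ℂ) ^ n ∧ c / b ≠ (q : ℂ) ^ n ∧ d / a ≠ (q : ℂ) ^ n ∧
      d / b ≠ (q : ℂ) ^ n ∧ c * d / (a * b) ≠ (q : ℂ) ^ n}

/-! ### The second order `q`-difference operator -/

/-- `s = √(cdq/ab)`, principal branch. -/
def sPar (q : ℝ) (a b c d : ℂ) : ℂ := (c * d * (q : ℂ) / (a * b)) ^ (1 / 2 : ℂ)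

/-- `A(x) = s⁻¹ (1 - q/ax)(1 - q/bx)`. -/
def coeffA (q : ℝ) (a b c d : ℂ) (x : ℝ) : ℂ :=
  (sPar q a b c d)⁻¹ * (1 - (q : ℂ) / (a * (x : ℂ))) * (1 - (q : ℂ) / (b * (x : ℂ)))

/-- `B(x) = s (1 - 1/cx)(1 - 1/dx)`. -/
def coeffB (q : ℝ) (a b c d : ℂ) (x : ℝ) : ℂ :=
  sPar q a b c d * (1 - 1 / (c * (x : ℂ))) * (1 - 1 / (d * (x : ℂ)))

/-- `C(x) = s⁻¹ + s - A(x) - B(x)`. -/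
def coeffC (q : ℝ) (a b c d : ℂ) (x : ℝ) : ℂ :=
  (sPar q a b c d)⁻¹ + sPar q a b c d - coeffA q a b c d x - coeffB q a b c d x

/-- The operator `L` on functions on `ℝ_q`:
`(Lf)(x) = A(x) f(x/q) + B(x) f(qx) + C(x) f(x)`. -/
def opL (q zp zm : ℝ) (a b c d : ℂ) : (Rq q zp zm → ℂ) →ₗ[ℂ] (Rq q zp zm → ℂ) where
  toFun f := fun x => coeffA q a b c d x * f (shiftDown x) + coeffB q a b c d x * f (shiftUp x)
    + coeffC q a b c d x * f x
  map_add' f g := by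
    funext x
    simp only [Pi.add_apply]
    ring
  map_smul' r f := by
    funext x
    simp only [Pi.smul_apply, smul_eq_mul, RingHom.id_apply]
    ring

/-! ### The Casorati determinant -/

/-- The weight `w(x) = (ax, bx; q)_∞ / (cx, dx; q)_∞`. -/
def weight (q : ℝ) (a b c d : ℂ) (x : ℝ) : ℂ :=
  (qPochInf q (a * (x : ℂ)) * qPochInf q (b * (x : ℂ))) /
    (qPochInf q (c * (x : ℂ)) * qPochInf q (d * (x : ℂ)))

/-- `u(x) = (1-q)² B(x) x² w(x)`. -/
def uFun (q : ℝ) (a b c d : ℂ) (x : ℝ) : ℂ :=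
  (1 - (q : ℂ)) ^ 2 * coeffB q a b c d x * (x : ℂ) ^ 2 * weight q a b c d x

/-- The Casorati determinant
`D(f,g)(x) = (f(x) g(qx) - f(qx) g(x)) u(x) / ((1-q) x)`. -/
def casorati (q zp zm : ℝ) (a b c d : ℂ) (f g : Rq q zp zm → ℂ) (x : Rq q zp zm) : ℂ :=
  (f x * g (shiftUp x) - f (shiftUp x) * g x) *
    (uFun q a b c d x / ((1 - (q : ℂ)) * ((x : ℝ) : ℂ)))

/-! ### The eigenspaces `V_μ` -/

/-- The `q`-derivative `(D_q f)(x) = (f(x) - f(qx)) / (x (1-q))`. -/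
def qDeriv {q zp zm : ℝ} (f : Rq q zp zm → ℂ) (x : Rq q zp zm) : ℂ :=
  (f x - f (shiftUp x)) / (((x : ℝ) : ℂ) * (1 - (q : ℂ)))

/-- `f(0⁻)` and `f(0⁺)` exist and are equal. -/
def ContAtZero {q zp zm : ℝ} (f : Rq q zp zm → ℂ) : Prop :=
  ∃ l : ℂ, Tendsto (fun k : ℕ => f (ptMinus q zp zm k)) atTop (𝓝 l) ∧
    Tendsto (fun k : ℕ => f (ptPlus q zp zm k)) atTop (𝓝 l)

theorem ContAtZero.add {q zp zm : ℝ} {f g : Rq q zp zm → ℂ} (hf : ContAtZero f)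
    (hg : ContAtZero g) : ContAtZero (f + g) := by
  obtain ⟨l, h1, h2⟩ := hf
  obtain ⟨m, h3, h4⟩ := hg
  exact ⟨l + m, h1.add h3, h2.add h4⟩

theorem ContAtZero.smul {q zp zm : ℝ} {f : Rq q zp zm → ℂ} (r : ℂ) (hf : ContAtZero f) :
    ContAtZero (r • f) := by
  obtain ⟨l, h1, h2⟩ := hf
  exact ⟨r * l, h1.const_mul r, h2.const_mul r⟩

theorem ContAtZero.zero {q zp zm : ℝ} : ContAtZero (0 : Rq q zp zm → ℂ) :=
  ⟨0, tendsto_const_nhds, tendsto_const_nhds⟩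

theorem qDeriv_add {q zp zm : ℝ} (f g : Rq q zp zm → ℂ) :
    qDeriv (f + g) = qDeriv f + qDeriv g := by
  funext x
  simp only [qDeriv, Pi.add_apply]
  ring

theorem qDeriv_smul {q zp zm : ℝ} (r : ℂ) (f : Rq q zp zm → ℂ) :
    qDeriv (r • f) = r • qDeriv f := by
  funext x
  simp only [qDeriv, Pi.smul_apply, smul_eq_mul]
  ring

theorem qDeriv_zero {q zp zm : ℝ} : qDeriv (0 : Rq q zp zm → ℂ) = 0 := by
  funext x
  simp [qDeriv]

/-- `V_μ = {f : ℝ_q → ℂ | Lf = μ f, f(0⁻) = f(0⁺), f'(0⁻) = f'(0⁺)}`. -/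
def eigenspaceV (q zp zm : ℝ) (a b c d : ℂ) (μ : ℂ) : Submodule ℂ (Rq q zp zm → ℂ) where
  carrier := {f | opL q zp zm a b c d f = μ • f ∧ ContAtZero f ∧ ContAtZero (qDeriv f)}
  add_mem' := by
    rintro f g ⟨h1, h2, h3⟩ ⟨k1, k2, k3⟩
    refine ⟨?_, h2.add k2, ?_⟩
    · rw [map_add, h1, k1, smul_add]
    · rw [qDeriv_add]
      exact h3.add k3
  zero_mem' := by
    refine ⟨by simp, ContAtZero.zero, ?_⟩
    rw [qDeriv_zero]
    exact ContAtZero.zero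
  smul_mem' := by
    rintro r f ⟨h1, h2, h3⟩
    refine ⟨?_, h2.smul r, ?_⟩
    · rw [map_smul, h1, smul_comm]
    · rw [qDeriv_smul]
      exact h3.smul r

/-! ### Big `q`-Jacobi functions -/

/-- `μ(γ) = γ + γ⁻¹`. -/
def eigenvalue (γ : ℂ) : ℂ := γ + γ⁻¹

/-- The series `₃φ₂(q/ax, sγ, s/γ; cq/a, dq/a; q, bx)`. -/
def phiSeries (q : ℝ) (a b c d γ : ℂ) (x : ℝ) : ℂ :=
  phi32 q ((q : ℂ) / (a * (x : ℂ))) (sPar q a b c d * γ) (sPar q a b c d / γ)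
    (c * (q : ℂ) / a) (d * (q : ℂ) / a) (b * (x : ℂ))

/-- At most `n` steps of the recurrence
`A(qx) f(x) = (μ(γ) - C(qx)) f(qx) - B(qx) f(q²x)`, which is the eigenvalue equation at the
point `qx`, started from the series on `|x| < 1/|b|`. -/
def phiAux (q : ℝ) (a b c d γ : ℂ) : ℕ → ℝ → ℂ
  | 0, x => phiSeries q a b c d γ x
  | n + 1, x =>
    if |x| < 1 / ‖b‖ then phiSeries q a b c d γ x
    else ((eigenvalue γ - coeffC q a b c d (q * x)) * phiAux q a b c d γ n (q * x)
      - coeffB q a b c d (q * x) * phiAux q a b c d γ n (q * (q * x))) / coeffA q a b c d (q * x)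

/-- The least `n` with `q^n |x| < 1/|b|`. -/
def numSteps (q : ℝ) (b : ℂ) (x : ℝ) : ℕ := sInf {n : ℕ | q ^ n * |x| < 1 / ‖b‖}

/-- The big `q`-Jacobi function `φ_γ(· ; a,b,c,d|q)` on `ℝ_q`: the series where `|x| < 1/|b|`,
extended to all of `ℝ_q` by the eigenvalue equation. See `bigqJacobi_eq_series`,
`bigqJacobi_recurrence` and `eq_bigqJacobi`. -/
def bigqJacobi (q zp zm : ℝ) (a b c d γ : ℂ) (x : Rq q zp zm) : ℂ :=
  phiAux q a b c d γ (numSteps q b x) x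

/-- `φ_γ^†`: the big `q`-Jacobi function with `a` and `b` interchanged. -/
def bigqJacobiDagger (q zp zm : ℝ) (a b c d γ : ℂ) : Rq q zp zm → ℂ :=
  bigqJacobi q zp zm b a c d γ

/-- `S_pol = {s q^k} ∪ {s⁻¹ q^{-k}}`, `k ≥ 0`. -/
def Spol (q : ℝ) (a b c d : ℂ) : Set ℂ :=
  {γ | ∃ k : ℕ, γ = sPar q a b c d * (q : ℂ) ^ k ∨
    γ = (sPar q a b c d)⁻¹ * ((q : ℂ) ^ k)⁻¹}

/-! ### The extension is the one determined by the eigenvalue equation -/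

theorem bigqJacobi_eq_series {q zp zm : ℝ} (a b c d γ : ℂ) (x : Rq q zp zm)
    (hx : |(x : ℝ)| < 1 / ‖b‖) :
    bigqJacobi q zp zm a b c d γ x = phiSeries q a b c d γ x := by
  have h : numSteps q b x = 0 := by
    refine Nat.sInf_eq_zero.2 (Or.inl ?_)
    simpa using hx
  rw [bigqJacobi, h, phiAux]

theorem phiAux_succ {q : ℝ} (hq0 : 0 < q) (hq1 : q < 1) (a b c d γ : ℂ) (n : ℕ) :
    ∀ x : ℝ, q ^ n * |x| < 1 / ‖b‖ → phiAux q a b c d γ (n + 1) x = phiAux q a b c d γ n x := by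
  induction n with
  | zero =>
    intro x hx
    rw [phiAux, phiAux, if_pos (by simpa using hx)]
  | succ n ih =>
    intro x hx
    have h1 : q ^ n * |q * x| < 1 / ‖b‖ := by
      rw [abs_mul, abs_of_pos hq0]
      calc q ^ n * (q * |x|) = q ^ (n + 1) * |x| := by ring
        _ < _ := hx
    have h2 : q ^ n * |q * (q * x)| < 1 / ‖b‖ := by
      refine lt_of_le_of_lt ?_ h1
      rw [abs_mul q, abs_of_pos hq0]
      have : 0 ≤ q ^ n * |q * x| := by positivity
      nlinarith
    rw [phiAux, ih _ h1, ih _ h2]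
    rfl

theorem phiAux_of_le {q : ℝ} (hq0 : 0 < q) (hq1 : q < 1) (a b c d γ : ℂ) {m n : ℕ} (h : m ≤ n)
    (x : ℝ) (hx : q ^ m * |x| < 1 / ‖b‖) :
    phiAux q a b c d γ n x = phiAux q a b c d γ m x := by
  induction n, h using Nat.le_induction with
  | base => rfl
  | succ n hn ih =>
    rw [phiAux_succ hq0 hq1, ih]
    refine lt_of_le_of_lt ?_ hx
    exact mul_le_mul_of_nonneg_right (pow_le_pow_of_le_one hq0.le hq1.le hn) (abs_nonneg x)

theorem numSteps_spec {q : ℝ} (hq0 : 0 < q) (hq1 : q < 1) {b : ℂ} (hb : b ≠ 0) (x : ℝ) :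
    q ^ numSteps q b x * |x| < 1 / ‖b‖ := by
  have hne : {n : ℕ | q ^ n * |x| < 1 / ‖b‖}.Nonempty := by
    have h := (tendsto_pow_atTop_nhds_zero_of_lt_one hq0.le hq1).mul_const |x|
    rw [zero_mul] at h
    have hpos : 0 < 1 / ‖b‖ := by positivity
    exact (h.eventually (gt_mem_nhds hpos)).exists
  exact Nat.sInf_mem hne

theorem bigqJacobi_eq_phiAux {q zp zm : ℝ} (hq0 : 0 < q) (hq1 : q < 1) (a : ℂ) {b : ℂ}
    (hb : b ≠ 0) (c d γ : ℂ) (x : Rq q zp zm) {n : ℕ} (hn : q ^ n * |(x : ℝ)| < 1 / ‖b‖) :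
    phiAux q a b c d γ n x = bigqJacobi q zp zm a b c d γ x :=
  phiAux_of_le hq0 hq1 a b c d γ (Nat.sInf_le hn) x (numSteps_spec hq0 hq1 hb x)

theorem bigqJacobi_recurrence {q zp zm : ℝ} (hq0 : 0 < q) (hq1 : q < 1) (a : ℂ) {b : ℂ}
    (hb : b ≠ 0) (c d γ : ℂ) (x : Rq q zp zm) (hx : ¬ |(x : ℝ)| < 1 / ‖b‖) :
    bigqJacobi q zp zm a b c d γ x =
      ((eigenvalue γ - coeffC q a b c d (shiftUp x)) * bigqJacobi q zp zm a b c d γ (shiftUp x)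
        - coeffB q a b c d (shiftUp x) * bigqJacobi q zp zm a b c d γ (shiftUp (shiftUp x))) /
        coeffA q a b c d (shiftUp x) := by
  have h0 := numSteps_spec hq0 hq1 hb x
  set n := numSteps q b x with hn
  have h1 : q ^ n * |((shiftUp x : Rq q zp zm) : ℝ)| < 1 / ‖b‖ := by
    refine lt_of_le_of_lt ?_ h0
    simp only [shiftUp, abs_mul, abs_of_pos hq0]
    have : 0 ≤ q ^ n * |(x : ℝ)| := by positivity
    nlinarith
  have h2 : q ^ n * |((shiftUp (shiftUp x) : Rq q zp zm) : ℝ)| < 1 / ‖b‖ := by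
    refine lt_of_le_of_lt ?_ h1
    simp only [shiftUp, abs_mul, abs_of_pos hq0]
    have : 0 ≤ q ^ n * (q * |(x : ℝ)|) := by positivity
    nlinarith
  rw [← bigqJacobi_eq_phiAux hq0 hq1 a hb c d γ _ h1,
    ← bigqJacobi_eq_phiAux hq0 hq1 a hb c d γ _ h2,
    bigqJacobi, ← hn, ← phiAux_succ hq0 hq1 a b c d γ n x h0, phiAux, if_neg hx]
  rfl

/-- Any solution of the eigenvalue equation on `ℝ_q` that agrees with the series for
`|x| < 1/|b|` is the big `q`-Jacobi function. -/
theorem eq_bigqJacobi {q zp zm : ℝ} (hq0 : 0 < q) (hq1 : q < 1) {a b c d : ℂ} (hb : b ≠ 0)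
    (γ : ℂ) (hA : ∀ x : Rq q zp zm, coeffA q a b c d x ≠ 0) (f : Rq q zp zm → ℂ)
    (hL : opL q zp zm a b c d f = eigenvalue γ • f)
    (hf : ∀ x : Rq q zp zm, |(x : ℝ)| < 1 / ‖b‖ → f x = phiSeries q a b c d γ x) :
    f = bigqJacobi q zp zm a b c d γ := by
  have key : ∀ n : ℕ, ∀ x : Rq q zp zm, q ^ n * |(x : ℝ)| < 1 / ‖b‖ →
      f x = bigqJacobi q zp zm a b c d γ x := by
    intro n
    induction n with
    | zero =>
      intro x hx
      have hx' : |(x : ℝ)| < 1 / ‖b‖ := by simpa using hx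
      rw [hf x hx', bigqJacobi_eq_series a b c d γ x hx']
    | succ n ih =>
      intro x hx
      by_cases hx' : |(x : ℝ)| < 1 / ‖b‖
      · rw [hf x hx', bigqJacobi_eq_series a b c d γ x hx']
      have h1 : q ^ n * |((shiftUp x : Rq q zp zm) : ℝ)| < 1 / ‖b‖ := by
        simp only [shiftUp, abs_mul, abs_of_pos hq0]
        calc q ^ n * (q * |(x : ℝ)|) = q ^ (n + 1) * |(x : ℝ)| := by ring
          _ < _ := hx
      have h2 : q ^ n * |((shiftUp (shiftUp x) : Rq q zp zm) : ℝ)| < 1 / ‖b‖ := by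
        refine lt_of_le_of_lt ?_ h1
        simp only [shiftUp, abs_mul, abs_of_pos hq0]
        have : 0 ≤ q ^ n * (q * |(x : ℝ)|) := by positivity
        nlinarith
      rw [bigqJacobi_recurrence hq0 hq1 a hb c d γ x hx', ← ih _ h1, ← ih _ h2,
        eq_div_iff (hA _)]
      have hE := congrFun hL (shiftUp x)
      have hs : shiftDown (shiftUp x) = x := by
        apply Subtype.ext
        simp only [shiftDown, shiftUp]
        field_simp
      simp only [opL, LinearMap.coe_mk, AddHom.coe_mk, Pi.smul_apply, smul_eq_mul, hs] at hE
      linear_combination hE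
  funext x
  exact key _ x (numSteps_spec hq0 hq1 hb x)

end BigQJacobi

end

/-!
The Casorati determinant `D(f, g)` of two solutions of `Lf = μf` is invariant under `x ↦ qx`, so
on each half of `ℝ_q` it equals its limit at the origin. This limit is
`(1-q)² s/(cd) · (f'(0) g(0) - f(0) g'(0))`, and the two halves share it because elements of `V_μ`
have matching values and derivatives at `0`. Hence `D(f, g)` is constant on `ℝ_q`
(`casorati_eq_limit`, `casorati_eq`).

The series for `φ_γ` is a sum of polynomials in `x`, because `(q/ax;q)_k (bx)^k` is one, and it
converges to a function analytic on the disc `|x| < 1/|b|`, origin included (`phiFun`). On each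
of these polynomials `L - μ(γ)` acts by a two-term recurrence, so that the partial sums of
`(L - μ(γ)) φ_γ` telescope to zero (`operator_phiFun`). Therefore `φ_γ` and `φ_γ^†` belong to
`V_{μ(γ)}`.

To evaluate `D(φ_γ, φ_γ^†)`, note that its constancy extends to complex `x` near the origin. When
`|b| ≤ |a|`, let `x = t/a` with `t → 1⁻`. The weight has a simple zero at `x = 1/a`, which is
cancelled only by the pole of `φ_γ^†` there. By an Abel type limit theorem
(`tendsto_one_sub_mul_tsum_qPoch`) the residue of that pole is read off from the limit of the
coefficients of the series, and `φ_γ(q/a) = 1` since all terms but the first vanish. This gives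
`casoratiZero_of_norm_le`; the case `|a| ≤ |b|` follows by interchanging `a` and `b` and using
`θ(1/x) = -θ(x)/x`.

If `γ ∉ S_pol`, the constant is nonzero: `a/b` is not a power of `q`
(`PairDomain.div_ne_zpow`), so the theta factor does not vanish. Then `φ_γ` and `φ_γ^†` are linearly
independent, and Cramer's rule with constant Casorati determinants writes every element of
`V_{μ(γ)}` as a combination of them (`exists_basis_of_casorati_ne_zero`).
-/

noncomputable section

namespace BigQJacobi

/-! ### `q`-shifted factorials -/

theorem qPoch_zero (q : ℝ) (x : ℂ) : qPoch q x 0 = 1 := by simp [qPoch]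

theorem qPoch_succ (q : ℝ) (x : ℂ) (n : ℕ) :
    qPoch q x (n + 1) = qPoch q x n * (1 - x * (q : ℂ) ^ n) := by
  simp [qPoch, Finset.prod_range_succ]

theorem qPoch_ne_zero {q : ℝ} {x : ℂ} (h : ∀ k : ℕ, x * (q : ℂ) ^ k ≠ 1) (n : ℕ) :
    qPoch q x n ≠ 0 :=
  Finset.prod_ne_zero_iff.2 fun k _ => sub_ne_zero.2 (h k).symm

theorem norm_ofReal_pow {q : ℝ} (hq0 : 0 < q) (n : ℕ) : ‖(q : ℂ) ^ n‖ = q ^ n := by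
  rw [norm_pow, Complex.norm_real, Real.norm_of_nonneg hq0.le]

theorem summable_norm_mul_pow {q : ℝ} (hq0 : 0 < q) (hq1 : q < 1) (x : ℂ) :
    Summable fun k : ℕ => ‖-(x * (q : ℂ) ^ k)‖ := by
  simp only [norm_neg, norm_mul, norm_ofReal_pow hq0]
  exact (summable_geometric_of_lt_one hq0.le hq1).mul_left _

theorem multipliable_qPochInf {q : ℝ} (hq0 : 0 < q) (hq1 : q < 1) (x : ℂ) :
    Multipliable fun k : ℕ => 1 - x * (q : ℂ) ^ k := by
  simpa only [sub_eq_add_neg] using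
    multipliable_one_add_of_summable (summable_norm_mul_pow hq0 hq1 x)

theorem tendsto_qPoch {q : ℝ} (hq0 : 0 < q) (hq1 : q < 1) (x : ℂ) :
    Tendsto (qPoch q x) atTop (𝓝 (qPochInf q x)) :=
  (multipliable_qPochInf hq0 hq1 x).hasProd.tendsto_prod_nat

theorem qPochInf_ne_zero {q : ℝ} (hq0 : 0 < q) (hq1 : q < 1) {x : ℂ}
    (h : ∀ k : ℕ, x * (q : ℂ) ^ k ≠ 1) : qPochInf q x ≠ 0 := by
  have := tprod_one_add_ne_zero_of_summable (f := fun k : ℕ => -(x * (q : ℂ) ^ k))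
    (fun k => by rw [← sub_eq_add_neg]; exact sub_ne_zero.2 (h k).symm)
    (summable_norm_mul_pow hq0 hq1 x)
  simpa only [qPochInf, sub_eq_add_neg] using this

theorem qPochInf_eq_mul {q : ℝ} (hq0 : 0 < q) (hq1 : q < 1) (x : ℂ) :
    qPochInf q x = (1 - x) * qPochInf q ((q : ℂ) * x) := by
  have h1 : Tendsto (fun n => qPoch q x (n + 1)) atTop (𝓝 (qPochInf q x)) :=
    (tendsto_qPoch hq0 hq1 x).comp (tendsto_add_atTop_nat 1)
  have h2 := (tendsto_qPoch hq0 hq1 ((q : ℂ) * x)).const_mul (1 - x)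
  refine tendsto_nhds_unique h1 (h2.congr fun n => ?_)
  rw [qPoch, qPoch, Finset.prod_range_succ', mul_comm]
  simp only [pow_zero, mul_one]
  congr 1
  exact Finset.prod_congr rfl fun k _ => by ring

theorem qPochInf_zero (q : ℝ) : qPochInf q 0 = 1 := by simp [qPochInf]

/-- A bound for `(x;q)_n` that is uniform in `n` and in `x` on bounded sets. -/
theorem norm_qPoch_le {q R : ℝ} (hq0 : 0 < q) (hq1 : q < 1) {x : ℂ} (hx : ‖x‖ ≤ R) (n : ℕ) :
    ‖qPoch q x n‖ ≤ Real.exp (R * (1 - q)⁻¹) := by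
  have hR : 0 ≤ R := (norm_nonneg x).trans hx
  calc ‖qPoch q x n‖ = ∏ k ∈ Finset.range n, ‖1 - x * (q : ℂ) ^ k‖ := norm_prod _ _
    _ ≤ ∏ k ∈ Finset.range n, Real.exp (R * q ^ k) := by
        refine Finset.prod_le_prod (fun _ _ => norm_nonneg _) fun k _ => ?_
        calc ‖1 - x * (q : ℂ) ^ k‖ ≤ ‖(1 : ℂ)‖ + ‖x * (q : ℂ) ^ k‖ := norm_sub_le _ _
          _ ≤ 1 + R * q ^ k := by
              rw [norm_one, norm_mul, norm_ofReal_pow hq0]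
              gcongr
          _ ≤ Real.exp (R * q ^ k) := by
              rw [add_comm]; exact Real.add_one_le_exp _
    _ = Real.exp (∑ k ∈ Finset.range n, R * q ^ k) := (Real.exp_sum _ _).symm
    _ ≤ Real.exp (R * (1 - q)⁻¹) := by
        rw [← Finset.mul_sum, ← tsum_geometric_of_lt_one hq0.le hq1]
        gcongr
        exact (summable_geometric_of_lt_one hq0.le hq1).sum_le_tsum _
          fun k _ => pow_nonneg hq0.le k

theorem continuous_qPoch (q : ℝ) (n : ℕ) : Continuous fun x : ℂ => qPoch q x n := by
  unfold qPoch
  fun_prop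

/-- `(x;q)_∞` as a locally uniformly convergent telescoping series. -/
theorem hasSum_qPochInf {q : ℝ} (hq0 : 0 < q) (hq1 : q < 1) (x : ℂ) :
    HasSum (fun k : ℕ => qPoch q x k * (x * (q : ℂ) ^ k)) (1 - qPochInf q x) := by
  have hs : Summable fun k : ℕ => qPoch q x k * (x * (q : ℂ) ^ k) := by
    refine Summable.of_norm_bounded (g := fun k => Real.exp (‖x‖ * (1 - q)⁻¹) * (‖x‖ * q ^ k))
      (((summable_geometric_of_lt_one hq0.le hq1).mul_left ‖x‖).mul_left _) fun k => ?_
    rw [norm_mul, norm_mul, norm_ofReal_pow hq0]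
    exact mul_le_mul_of_nonneg_right (norm_qPoch_le hq0 hq1 le_rfl k) (by positivity)
  rw [hs.hasSum_iff_tendsto_nat]
  refine ((tendsto_qPoch hq0 hq1 x).const_sub 1).congr fun n => ?_
  induction n with
  | zero => simp [qPoch_zero]
  | succ n ih => rw [Finset.sum_range_succ, ← ih, qPoch_succ]; ring

theorem continuous_qPochInf {q : ℝ} (hq0 : 0 < q) (hq1 : q < 1) : Continuous (qPochInf q) := by
  have h : ∀ R : ℝ, ContinuousOn
      (fun x => 1 - ∑' k : ℕ, qPoch q x k * (x * (q : ℂ) ^ k)) (Metric.ball 0 R) := by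
    intro R
    refine continuousOn_const.sub (continuousOn_tsum
      (u := fun k => Real.exp (R * (1 - q)⁻¹) * (R * q ^ k)) (fun k => ?_)
      (((summable_geometric_of_lt_one hq0.le hq1).mul_left R).mul_left _) fun k x hx => ?_)
    · exact ((continuous_qPoch q k).mul (by fun_prop)).continuousOn
    · have hx' : ‖x‖ ≤ R := (mem_ball_zero_iff.1 hx).le
      rw [norm_mul, norm_mul, norm_ofReal_pow hq0]
      have := norm_qPoch_le hq0 hq1 hx' k
      gcongr
  have e : qPochInf q = fun x => 1 - ∑' k : ℕ, qPoch q x k * (x * (q : ℂ) ^ k) := by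
    funext x
    rw [(hasSum_qPochInf hq0 hq1 x).tsum_eq]; ring
  rw [e, continuous_iff_continuousAt]
  intro x
  exact (h (‖x‖ + 1)).continuousAt (Metric.isOpen_ball.mem_nhds (by simp))

/-- The relation `θ(1/x) = -θ(x)/x`. -/
theorem theta_inv {q : ℝ} (hq0 : 0 < q) (hq1 : q < 1) {x : ℂ} (hx : x ≠ 0) :
    theta q x⁻¹ = -x⁻¹ * theta q x := by
  rw [theta, theta, qPochInf_eq_mul hq0 hq1 x⁻¹, qPochInf_eq_mul hq0 hq1 x, div_inv_eq_mul,
    ← div_eq_mul_inv]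
  field_simp
  ring

theorem theta_ne_zero {q : ℝ} (hq0 : 0 < q) (hq1 : q < 1) {x : ℂ}
    (h : ∀ n : ℤ, x ≠ (q : ℂ) ^ n) : theta q x ≠ 0 := by
  have hq : (q : ℂ) ≠ 0 := by exact_mod_cast hq0.ne'
  have hqk : ∀ k : ℕ, (q : ℂ) ^ k ≠ 0 := fun k => pow_ne_zero k hq
  refine mul_ne_zero (qPochInf_ne_zero hq0 hq1 fun k hk => h (-k) ?_)
    (qPochInf_ne_zero hq0 hq1 fun k hk => h (k + 1) ?_)
  · rw [zpow_neg, zpow_natCast]; exact eq_inv_of_mul_eq_one_left hk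
  · have hx : x ≠ 0 := by rintro rfl; simp at hk
    rw [div_mul_eq_mul_div, div_eq_one_iff_eq hx] at hk
    rw [← hk, zpow_add_one₀ hq, zpow_natCast, mul_comm]

/-! ### Sequences with geometrically small increments -/

/-- The sequence `u` is bounded and its increments are `O(q^k)`. -/
def GeomIncr (q : ℝ) (u : ℕ → ℂ) : Prop :=
  ∃ C : ℝ, 0 ≤ C ∧ ∀ k, ‖u k‖ ≤ C ∧ ‖u (k + 1) - u k‖ ≤ C * q ^ k

theorem GeomIncr.mul {q : ℝ} (hq0 : 0 < q) {u v : ℕ → ℂ} (hu : GeomIncr q u)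
    (hv : GeomIncr q v) : GeomIncr q fun k => u k * v k := by
  obtain ⟨C, hC, h⟩ := hu
  obtain ⟨K, hK, h'⟩ := hv
  refine ⟨2 * (C * K), by positivity, fun k => ⟨?_, ?_⟩⟩
  · rw [norm_mul]
    have : ‖u k‖ * ‖v k‖ ≤ C * K := mul_le_mul (h k).1 (h' k).1 (norm_nonneg _) hC
    have : 0 ≤ C * K := by positivity
    linarith
  · have e : u (k + 1) * v (k + 1) - u k * v k
        = u (k + 1) * (v (k + 1) - v k) + (u (k + 1) - u k) * v k := by ring
    rw [e]
    have h1 : ‖u (k + 1)‖ * ‖v (k + 1) - v k‖ ≤ C * (K * q ^ k) :=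
      mul_le_mul (h _).1 (h' k).2 (norm_nonneg _) hC
    have h2 : ‖u (k + 1) - u k‖ * ‖v k‖ ≤ (C * q ^ k) * K :=
      mul_le_mul (h k).2 (h' k).1 (norm_nonneg _) (by positivity)
    calc _ ≤ _ := norm_add_le _ _
      _ ≤ _ := by rw [norm_mul, norm_mul]; nlinarith

theorem geomIncr_qPoch {q : ℝ} (hq0 : 0 < q) (hq1 : q < 1) (x : ℂ) :
    GeomIncr q (qPoch q x) := by
  set M := Real.exp (‖x‖ * (1 - q)⁻¹)
  have hM : 0 < M := Real.exp_pos _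
  have hb := norm_qPoch_le hq0 hq1 (le_refl ‖x‖)
  have hx := norm_nonneg x
  refine ⟨M * (1 + ‖x‖), by positivity, fun k => ⟨(hb k).trans ?_, ?_⟩⟩
  · change M ≤ _
    nlinarith
  · have e : qPoch q x (k + 1) - qPoch q x k = -(qPoch q x k * (x * (q : ℂ) ^ k)) := by
      rw [qPoch_succ]; ring
    rw [e, norm_neg, norm_mul, norm_mul, norm_ofReal_pow hq0, mul_assoc]
    have := hb k
    gcongr
    linarith

theorem geomIncr_inv_qPoch {q : ℝ} (hq0 : 0 < q) (hq1 : q < 1) {x : ℂ}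
    (h : ∀ k : ℕ, x * (q : ℂ) ^ k ≠ 1) : GeomIncr q fun k => (qPoch q x k)⁻¹ := by
  obtain ⟨K, hK⟩ :=
    ((tendsto_qPoch hq0 hq1 x).inv₀ (qPochInf_ne_zero hq0 hq1 h)).norm.bddAbove_range
  have hb : ∀ k, ‖(qPoch q x k)⁻¹‖ ≤ K := fun k => hK ⟨k, rfl⟩
  have hK0 : 0 ≤ K := (norm_nonneg _).trans (hb 0)
  have hx := norm_nonneg x
  refine ⟨K * (1 + ‖x‖), by positivity, fun k => ⟨(hb k).trans ?_, ?_⟩⟩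
  · nlinarith
  · have h0 := qPoch_ne_zero h k
    have h1 : 1 - x * (q : ℂ) ^ k ≠ 0 := sub_ne_zero.2 (h k).symm
    have e : (qPoch q x (k + 1))⁻¹ - (qPoch q x k)⁻¹
        = (qPoch q x (k + 1))⁻¹ * (x * (q : ℂ) ^ k) := by
      rw [qPoch_succ]; field_simp; ring
    rw [e, norm_mul, norm_mul, norm_ofReal_pow hq0, mul_assoc]
    have := hb (k + 1)
    gcongr
    linarith

/-! ### An Abel type limit theorem -/

/-- Summation by parts for a power series with bounded coefficients. -/
theorem one_sub_mul_tsum {c : ℕ → ℂ} {C : ℝ} (hc : ∀ k, ‖c k‖ ≤ C) {z : ℂ} (hz : ‖z‖ < 1) :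
    (1 - z) * ∑' k, c k * z ^ k = c 0 + ∑' k, (c (k + 1) - c k) * z ^ (k + 1) := by
  have hs : Summable fun k => c k * z ^ k := by
    refine Summable.of_norm_bounded
      ((summable_geometric_of_lt_one (norm_nonneg z) hz).mul_left C) fun k => ?_
    rw [norm_mul, norm_pow]
    exact mul_le_mul_of_nonneg_right (hc k) (by positivity)
  have h1 : Summable fun k => c (k + 1) * z ^ (k + 1) :=
    (summable_nat_add_iff (f := fun k => c k * z ^ k) 1).2 hs
  have h2 : Summable fun k => c k * z ^ (k + 1) :=
    (hs.mul_left z).congr fun k => by ring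
  have e2 : ∑' k, c k * z ^ (k + 1) = z * ∑' k, c k * z ^ k := by
    rw [← tsum_mul_left]; exact tsum_congr fun k => by ring
  have e1 : ∑' k, c k * z ^ k = c 0 + ∑' k, c (k + 1) * z ^ (k + 1) := by
    rw [hs.tsum_eq_zero_add]; simp
  simp_rw [sub_mul]
  rw [h1.tsum_sub h2, e2, one_mul]
  linear_combination e1

/-- If the coefficients `c_k(t)` have increments `O(q^k)`, uniformly in `t`, then
`(1 - ωt) ∑ c_k(t) (ωt)^k` has a limit as `t → 1⁻`, also for `|ω| = 1`. -/
theorem tendsto_one_sub_mul_tsum {q C : ℝ} (hq0 : 0 < q) (hq1 : q < 1) {c : ℕ → ℝ → ℂ}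
    {l : ℕ → ℂ} {ω : ℂ} (hω : ‖ω‖ ≤ 1)
    (hc : ∀ t ∈ Set.Ioo (1 / 2 : ℝ) 1, ∀ k, ‖c k t‖ ≤ C ∧ ‖c (k + 1) t - c k t‖ ≤ C * q ^ k)
    (hl : ∀ k, Tendsto (c k) (𝓝[<] 1) (𝓝 (l k))) :
    Tendsto (fun t : ℝ => (1 - ω * t) * ∑' k, c k t * (ω * t) ^ k) (𝓝[<] 1)
      (𝓝 (l 0 + ∑' k, (l (k + 1) - l k) * ω ^ (k + 1))) := by
  have hev : ∀ᶠ t : ℝ in 𝓝[<] 1, t ∈ Set.Ioo (1 / 2 : ℝ) 1 :=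
    Ioo_mem_nhdsLT (by norm_num)
  have hnorm : ∀ t ∈ Set.Ioo (1 / 2 : ℝ) 1, ‖ω * (t : ℂ)‖ < 1 := by
    intro t ht
    have h0 : (0 : ℝ) < t := by linarith [ht.1]
    rw [norm_mul, Complex.norm_real, Real.norm_of_nonneg h0.le]
    nlinarith [ht.2, norm_nonneg ω]
  have htt : Tendsto (fun t : ℝ => (ω * t : ℂ)) (𝓝[<] 1) (𝓝 ω) := by
    have : Continuous fun t : ℝ => (ω * t : ℂ) := by fun_prop
    simpa using (this.tendsto 1).mono_left nhdsWithin_le_nhds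
  have key : Tendsto (fun t : ℝ => c 0 t + ∑' k, (c (k + 1) t - c k t) * (ω * t) ^ (k + 1))
      (𝓝[<] 1) (𝓝 (l 0 + ∑' k, (l (k + 1) - l k) * ω ^ (k + 1))) := by
    refine (hl 0).add (tendsto_tsum_of_dominated_convergence
      (bound := fun k => C * q ^ k) ((summable_geometric_of_lt_one hq0.le hq1).mul_left C)
      (fun k => ((hl (k + 1)).sub (hl k)).mul (htt.pow (k + 1))) ?_)
    filter_upwards [hev] with t ht k
    rw [norm_mul, norm_pow]
    calc _ ≤ ‖c (k + 1) t - c k t‖ * 1 :=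
          mul_le_mul_of_nonneg_left (pow_le_one₀ (norm_nonneg _) (hnorm t ht).le) (norm_nonneg _)
      _ ≤ _ := by rw [mul_one]; exact (hc t ht k).2
  refine key.congr' ?_
  filter_upwards [hev] with t ht
  exact (one_sub_mul_tsum (fun k => (hc t ht k).1) (hnorm t ht)).symm

/-! ### The analytic continuation of the series through the origin -/

/-- Nonzero parameters with `a ≠ b` such that no denominator in the series of `φ_γ` and `φ_γ^†`
vanishes. The conditions are symmetric in `a` and `b`. -/
structure Regular (q : ℝ) (a b c d : ℂ) : Prop where
  ha : a ≠ 0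
  hb : b ≠ 0
  hc : c ≠ 0
  hd : d ≠ 0
  hab : a ≠ b
  hca : ∀ k : ℕ, c * (q : ℂ) / a * (q : ℂ) ^ k ≠ 1
  hda : ∀ k : ℕ, d * (q : ℂ) / a * (q : ℂ) ^ k ≠ 1
  hcb : ∀ k : ℕ, c * (q : ℂ) / b * (q : ℂ) ^ k ≠ 1
  hdb : ∀ k : ℕ, d * (q : ℂ) / b * (q : ℂ) ^ k ≠ 1

theorem Regular.symm {q : ℝ} {a b c d : ℂ} (h : Regular q a b c d) : Regular q b a c d :=
  ⟨h.hb, h.ha, h.hc, h.hd, h.hab.symm, h.hcb, h.hdb, h.hca, h.hda⟩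

/-- The factor of the `k`-th term of the series that does not depend on `x`. -/
def phiCoeff (q : ℝ) (a b c d γ : ℂ) (k : ℕ) : ℂ :=
  qPoch q (sPar q a b c d * γ) k * qPoch q (sPar q a b c d / γ) k *
    ((qPoch q (q : ℂ) k)⁻¹ * (qPoch q (c * (q : ℂ) / a) k)⁻¹ * (qPoch q (d * (q : ℂ) / a) k)⁻¹)

/-- The polynomial `(q/ax;q)_k (bx)^k` in `x`, written without the removable singularity at
`x = 0`. -/
def phiPoly (q : ℝ) (a b : ℂ) (k : ℕ) (x : ℂ) : ℂ :=
  ∏ j ∈ Finset.range k, (b * x - b / a * (q : ℂ) ^ (j + 1))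

/-- The sum of the series for `φ_γ` as an analytic function on the disc `|x| < 1/|b|`, the origin
included. -/
def phiFun (q : ℝ) (a b c d γ x : ℂ) : ℂ :=
  ∑' k : ℕ, phiCoeff q a b c d γ k * phiPoly q a b k x

theorem qPoch_mul_pow {q : ℝ} {a x : ℂ} (ha : a ≠ 0) (b : ℂ) (hx : x ≠ 0) (k : ℕ) :
    qPoch q ((q : ℂ) / (a * x)) k * (b * x) ^ k = phiPoly q a b k x := by
  rw [qPoch, phiPoly, Finset.pow_eq_prod_const, ← Finset.prod_mul_distrib]
  refine Finset.prod_congr rfl fun j _ => ?_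
  field_simp
  ring

theorem phiSeries_eq_phiFun {q : ℝ} {a : ℂ} (ha : a ≠ 0) (b c d γ : ℂ) {x : ℝ} (hx : x ≠ 0) :
    phiSeries q a b c d γ x = phiFun q a b c d γ x := by
  refine tsum_congr fun k => ?_
  rw [← qPoch_mul_pow ha b (Complex.ofReal_ne_zero.2 hx), phiCoeff, div_eq_mul_inv, mul_inv,
    mul_inv]
  ring

theorem q_mul_pow_ne_one {q : ℝ} (hq0 : 0 < q) (hq1 : q < 1) (k : ℕ) :
    (q : ℂ) * (q : ℂ) ^ k ≠ 1 := by
  rw [← pow_succ']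
  exact_mod_cast (pow_lt_one₀ hq0.le hq1 k.succ_ne_zero).ne

theorem geomIncr_phiCoeff {q : ℝ} (hq0 : 0 < q) (hq1 : q < 1) {a b c d : ℂ}
    (h : Regular q a b c d) (γ : ℂ) : GeomIncr q (phiCoeff q a b c d γ) :=
  ((geomIncr_qPoch hq0 hq1 _).mul hq0 (geomIncr_qPoch hq0 hq1 _)).mul hq0
    (((geomIncr_inv_qPoch hq0 hq1 (q_mul_pow_ne_one hq0 hq1)).mul hq0
      (geomIncr_inv_qPoch hq0 hq1 h.hca)).mul hq0 (geomIncr_inv_qPoch hq0 hq1 h.hda))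

theorem tendsto_phiCoeff {q : ℝ} (hq0 : 0 < q) (hq1 : q < 1) {a b c d : ℂ}
    (h : Regular q a b c d) (γ : ℂ) : Tendsto (phiCoeff q a b c d γ) atTop
      (𝓝 (qPochInf q (sPar q a b c d * γ) * qPochInf q (sPar q a b c d / γ) *
        ((qPochInf q (q : ℂ))⁻¹ * (qPochInf q (c * (q : ℂ) / a))⁻¹ *
          (qPochInf q (d * (q : ℂ) / a))⁻¹))) :=
  ((tendsto_qPoch hq0 hq1 _).mul (tendsto_qPoch hq0 hq1 _)).mul
    ((((tendsto_qPoch hq0 hq1 _).inv₀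
      (qPochInf_ne_zero hq0 hq1 (q_mul_pow_ne_one hq0 hq1))).mul
        ((tendsto_qPoch hq0 hq1 _).inv₀ (qPochInf_ne_zero hq0 hq1 h.hca))).mul
          ((tendsto_qPoch hq0 hq1 _).inv₀ (qPochInf_ne_zero hq0 hq1 h.hda)))

theorem summable_prod_add_geometric {q r K : ℝ} (hq0 : 0 < q) (hq1 : q < 1) (hr0 : 0 < r)
    (hr1 : r < 1) (hK : 0 ≤ K) :
    Summable fun k : ℕ => ∏ j ∈ Finset.range k, (r + K * q ^ j) := by
  have hpos : ∀ j : ℕ, 0 < r + K * q ^ j := fun j => by positivity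
  have hp : ∀ k, 0 < ∏ j ∈ Finset.range k, (r + K * q ^ j) :=
    fun k => Finset.prod_pos fun j _ => hpos j
  refine summable_of_ratio_test_tendsto_lt_one hr1 (Eventually.of_forall fun k => (hp k).ne') ?_
  have h1 : Tendsto (fun k : ℕ => r + K * q ^ k) atTop (𝓝 r) := by
    simpa using ((tendsto_pow_atTop_nhds_zero_of_lt_one hq0.le hq1).const_mul K).const_add r
  refine h1.congr fun k => ?_
  rw [Real.norm_of_nonneg (hp _).le, Real.norm_of_nonneg (hp _).le, Finset.prod_range_succ,
    mul_div_cancel_left₀ _ (hp k).ne']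

theorem norm_phiPoly_le {q r : ℝ} (hq0 : 0 < q) (hq1 : q < 1) (a : ℂ) {b x : ℂ}
    (hx : ‖b * x‖ ≤ r) (k : ℕ) :
    ‖phiPoly q a b k x‖ ≤ ∏ j ∈ Finset.range k, (r + ‖b / a‖ * q ^ j) := by
  rw [phiPoly, norm_prod]
  refine Finset.prod_le_prod (fun _ _ => norm_nonneg _) fun j _ => ?_
  refine (norm_sub_le _ _).trans (add_le_add hx ?_)
  rw [norm_mul, norm_ofReal_pow hq0]
  exact mul_le_mul_of_nonneg_left (pow_le_pow_of_le_one hq0.le hq1.le j.le_succ) (norm_nonneg _)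

theorem norm_phiPoly_le_pow_mul {q r : ℝ} (hq0 : 0 < q) (a : ℂ) {b x : ℂ}
    (hx : ‖b * x‖ ≤ q * r) (k : ℕ) :
    ‖phiPoly q a b k x‖ ≤ q ^ k * ∏ j ∈ Finset.range k, (r + ‖b / a‖ * q ^ j) := by
  rw [phiPoly, norm_prod, Finset.pow_eq_prod_const, ← Finset.prod_mul_distrib]
  refine Finset.prod_le_prod (fun _ _ => norm_nonneg _) fun j _ => ?_
  refine (norm_sub_le _ _).trans ?_
  rw [norm_mul (b / a), norm_ofReal_pow hq0, pow_succ]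
  linarith

theorem norm_phi_term_le {q r K : ℝ} (hq0 : 0 < q) (hq1 : q < 1) {a b c d γ x : ℂ}
    (hK : ∀ k, ‖phiCoeff q a b c d γ k‖ ≤ K) (hx : ‖b * x‖ ≤ r) (k : ℕ) :
    ‖phiCoeff q a b c d γ k * phiPoly q a b k x‖
      ≤ K * ∏ j ∈ Finset.range k, (r + ‖b / a‖ * q ^ j) := by
  rw [norm_mul]
  exact mul_le_mul (hK k) (norm_phiPoly_le hq0 hq1 a hx k) (norm_nonneg _)
    ((norm_nonneg _).trans (hK k))

theorem hasSum_phiFun {q : ℝ} (hq0 : 0 < q) (hq1 : q < 1) {a b c d : ℂ}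
    (h : Regular q a b c d) (γ : ℂ) {x : ℂ} (hx : ‖b * x‖ < 1) :
    HasSum (fun k => phiCoeff q a b c d γ k * phiPoly q a b k x) (phiFun q a b c d γ x) := by
  obtain ⟨K, -, hK⟩ := geomIncr_phiCoeff hq0 hq1 h γ
  obtain ⟨r, hr, hr1⟩ := exists_between hx
  exact (Summable.of_norm_bounded ((summable_prod_add_geometric hq0 hq1
    ((norm_nonneg _).trans_lt hr) hr1 (norm_nonneg (b / a))).mul_left K)
    (norm_phi_term_le hq0 hq1 (fun k => (hK k).1) hr.le)).hasSum

theorem differentiableAt_phiFun {q : ℝ} (hq0 : 0 < q) (hq1 : q < 1) {a b c d : ℂ}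
    (h : Regular q a b c d) (γ : ℂ) {x : ℂ} (hx : ‖b * x‖ < 1) :
    DifferentiableAt ℂ (phiFun q a b c d γ) x := by
  obtain ⟨K, -, hK⟩ := geomIncr_phiCoeff hq0 hq1 h γ
  obtain ⟨r, hr, hr1⟩ := exists_between hx
  have hU : IsOpen {y : ℂ | ‖b * y‖ < r} :=
    isOpen_lt (by fun_prop) continuous_const
  refine (Complex.differentiableOn_tsum_of_summable_norm ((summable_prod_add_geometric hq0 hq1
    ((norm_nonneg _).trans_lt hr) hr1 (norm_nonneg (b / a))).mul_left K) (fun k => ?_) hU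
    fun k y hy => norm_phi_term_le hq0 hq1 (fun k => (hK k).1) (le_of_lt hy) k).differentiableAt
      (hU.mem_nhds hr)
  unfold phiPoly
  fun_prop

/-! ### The eigenvalue equation for the series -/

/-- `A(x)` at complex arguments. -/
def coeffAC (q : ℝ) (a b c d x : ℂ) : ℂ :=
  (sPar q a b c d)⁻¹ * (1 - (q : ℂ) / (a * x)) * (1 - (q : ℂ) / (b * x))

/-- `B(x)` at complex arguments. -/
def coeffBC (q : ℝ) (a b c d x : ℂ) : ℂ :=
  sPar q a b c d * (1 - 1 / (c * x)) * (1 - 1 / (d * x))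

theorem sPar_sq (q : ℝ) (a b c d : ℂ) :
    sPar q a b c d ^ 2 = c * d * (q : ℂ) / (a * b) := by
  rw [sPar, ← Complex.cpow_nat_mul]
  norm_num

theorem sPar_ne_zero {q : ℝ} (hq0 : 0 < q) {a b c d : ℂ} (h : Regular q a b c d) :
    sPar q a b c d ≠ 0 := by
  have hq : (q : ℂ) ≠ 0 := by exact_mod_cast hq0.ne'
  have := h.ha; have := h.hb; have := h.hc; have := h.hd
  refine fun h0 => ?_
  have h1 := sPar_sq q a b c d
  rw [h0, zero_pow two_ne_zero] at h1
  exact (by positivity : c * d * (q : ℂ) / (a * b) ≠ 0) h1.symm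

theorem sPar_swap (q : ℝ) (a b c d : ℂ) : sPar q b a c d = sPar q a b c d := by
  rw [sPar, sPar, mul_comm b a]

theorem phiPoly_succ (q : ℝ) (a b : ℂ) (k : ℕ) (x : ℂ) :
    phiPoly q a b (k + 1) x
      = phiPoly q a b k x * (b * x - b / a * (q : ℂ) ^ (k + 1)) :=
  Finset.prod_range_succ _ _

theorem phiPoly_q_mul (q : ℝ) (a b : ℂ) (k : ℕ) (x : ℂ) :
    phiPoly q a b (k + 1) (q * x)
      = (q : ℂ) ^ (k + 1) * (b * x - b / a) * phiPoly q a b k x := by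
  induction k with
  | zero => simp [phiPoly]; ring
  | succ k ih => rw [phiPoly_succ q a b (k + 1), ih, phiPoly_succ]; ring

theorem phiPoly_div_q {q : ℝ} (hq : (q : ℂ) ≠ 0) (a b : ℂ) (k : ℕ) (x : ℂ) :
    (b * x - b / a * q) * phiPoly q a b k (x / q)
      = ((q : ℂ) ^ k)⁻¹ * phiPoly q a b (k + 1) x := by
  rw [eq_inv_mul_iff_mul_eq₀ (pow_ne_zero k hq), phiPoly, phiPoly, Finset.prod_range_succ',
    Finset.pow_eq_prod_const, mul_left_comm, ← Finset.prod_mul_distrib, zero_add, pow_one, mul_comm]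
  congr 1
  refine Finset.prod_congr rfl fun j _ => ?_
  field_simp
  ring

/-- The action of `L - μ(γ)` on the `(k+1)`-st polynomial, after division by the `k`-th;
`Q` stands for `q^k`. -/
theorem recurrence_identity {q a b c d s γ x Q : ℂ} (hq : q ≠ 0) (ha : a ≠ 0) (hb : b ≠ 0)
    (hc : c ≠ 0) (hs : s ≠ 0) (hγ : γ ≠ 0) (hx : x ≠ 0) (hQ : Q ≠ 0)
    (hd : d = s ^ 2 * a * b / (c * q)) :
    s⁻¹ * (1 - q / (b * x)) / (b * x) * ((Q * q)⁻¹ * ((b * x - b / a * (Q * q)) *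
        (b * x - b / a * (Q * q * q)))) +
      s * (1 - 1 / (c * x)) * (1 - 1 / (d * x)) * (Q * q * (b * x - b / a)) +
      (s⁻¹ + s - s⁻¹ * (1 - q / (a * x)) * (1 - q / (b * x)) -
        s * (1 - 1 / (c * x)) * (1 - 1 / (d * x)) - (γ + γ⁻¹)) * (b * x - b / a * (Q * q)) =
    s⁻¹ * (Q * q)⁻¹ * (1 - s * γ * (Q * q)) * (1 - s / γ * (Q * q)) *
        (b * x - b / a * (Q * q)) -
      s⁻¹ * Q⁻¹ * ((1 - q * Q) * (1 - c * q / a * Q) * (1 - d * q / a * Q)) := by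
  subst hd
  field_simp
  ring

/-- The partial sums of `(L - μ(γ)) φ_γ` telescope: `L - μ(γ)` maps the `k`-th polynomial to a
combination of itself and the `(k-1)`-st, and the coefficients of the series are chosen so that
consecutive contributions cancel. -/
theorem sum_range_operator_phiPoly {q : ℝ} (hq0 : 0 < q) (hq1 : q < 1) {a b c d γ x : ℂ}
    (h : Regular q a b c d) (hγ : γ ≠ 0) (hx : x ≠ 0) (n : ℕ) :
    ∑ k ∈ Finset.range (n + 1),
      (coeffAC q a b c d x * (phiCoeff q a b c d γ k * phiPoly q a b k (x / q)) +
        coeffBC q a b c d x * (phiCoeff q a b c d γ k * phiPoly q a b k (q * x)) +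
        ((sPar q a b c d)⁻¹ + sPar q a b c d - coeffAC q a b c d x - coeffBC q a b c d x -
          (γ + γ⁻¹)) * (phiCoeff q a b c d γ k * phiPoly q a b k x)) =
      (sPar q a b c d)⁻¹ * ((q : ℂ) ^ n)⁻¹ * (1 - sPar q a b c d * γ * (q : ℂ) ^ n) *
        (1 - sPar q a b c d / γ * (q : ℂ) ^ n) *
        (phiCoeff q a b c d γ n * phiPoly q a b n x) := by
  have hq : (q : ℂ) ≠ 0 := by exact_mod_cast hq0.ne'
  have hs := sPar_ne_zero hq0 h
  have ha := h.ha; have hb := h.hb; have hc := h.hc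
  induction n with
  | zero =>
    simp only [zero_add, Finset.sum_range_one, phiPoly, Finset.prod_range_zero, phiCoeff,
      qPoch_zero, pow_zero]
    field_simp
    ring
  | succ n ih =>
    rw [Finset.sum_range_succ, ih]
    have hQ : (q : ℂ) ^ n ≠ 0 := pow_ne_zero n hq
    have hd : d = sPar q a b c d ^ 2 * a * b / (c * q) := by
      rw [sPar_sq]; field_simp
    have hden : (1 - (q : ℂ) * (q : ℂ) ^ n) * (1 - c * q / a * (q : ℂ) ^ n) *
        (1 - d * q / a * (q : ℂ) ^ n) ≠ 0 :=
      mul_ne_zero (mul_ne_zero (sub_ne_zero.2 (q_mul_pow_ne_one hq0 hq1 n).symm)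
        (sub_ne_zero.2 (h.hca n).symm)) (sub_ne_zero.2 (h.hda n).symm)
    have he : (1 - sPar q a b c d * γ * (q : ℂ) ^ n) * (1 - sPar q a b c d / γ * (q : ℂ) ^ n) *
        phiCoeff q a b c d γ n = (1 - (q : ℂ) * (q : ℂ) ^ n) * (1 - c * q / a * (q : ℂ) ^ n) *
        (1 - d * q / a * (q : ℂ) ^ n) * phiCoeff q a b c d γ (n + 1) := by
      simp only [phiCoeff, qPoch_succ, mul_inv]
      rw [mul_ne_zero_iff, mul_ne_zero_iff] at hden
      obtain ⟨⟨h1, h2⟩, h3⟩ := hden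
      generalize 1 - (q : ℂ) * (q : ℂ) ^ n = D1 at *
      generalize 1 - c * q / a * (q : ℂ) ^ n = D2 at *
      generalize 1 - d * q / a * (q : ℂ) ^ n = D3 at *
      field_simp
    -- `A(x) p(x/q)`, with the factor `bx - q b/a` of `A(x)` absorbed into the polynomial
    have hA : coeffAC q a b c d x * phiPoly q a b (n + 1) (x / q) =
        (sPar q a b c d)⁻¹ * (1 - q / (b * x)) / (b * x) * (((q : ℂ) ^ n * q)⁻¹ *
          ((b * x - b / a * ((q : ℂ) ^ n * q)) * (b * x - b / a * ((q : ℂ) ^ n * q * q)))) *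
          phiPoly q a b n x := by
      have e := phiPoly_div_q hq a b (n + 1) x
      rw [phiPoly_succ q a b (n + 1), phiPoly_succ q a b n x, pow_succ _ (n + 1), pow_succ] at e
      have e' : coeffAC q a b c d x = (sPar q a b c d)⁻¹ * (1 - q / (b * x)) / (b * x) *
          (b * x - b / a * q) := by
        rw [coeffAC]; field_simp
      rw [e', mul_assoc, e]
      ring
    have key := recurrence_identity (γ := γ) hq ha hb hc hs hγ hx hQ hd
    have hP := phiPoly_q_mul q a b n x
    have hP' := phiPoly_succ q a b n x
    rw [pow_succ] at hP hP'
    rw [pow_succ, hP', hP]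
    unfold coeffBC
    rw [show coeffAC q a b c d x * (phiCoeff q a b c d γ (n + 1) * phiPoly q a b (n + 1) (x / q))
      = coeffAC q a b c d x * phiPoly q a b (n + 1) (x / q) * phiCoeff q a b c d γ (n + 1) by ring,
      hA]
    unfold coeffAC
    linear_combination (phiCoeff q a b c d γ (n + 1) * phiPoly q a b n x) * key +
      ((sPar q a b c d)⁻¹ * ((q : ℂ) ^ n)⁻¹ * phiPoly q a b n x) * he

/-- `L φ_γ = μ(γ) φ_γ` where all three values are given by the series. -/
theorem operator_phiFun {q : ℝ} (hq0 : 0 < q) (hq1 : q < 1) {a b c d γ x : ℂ}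
    (h : Regular q a b c d) (hγ : γ ≠ 0) (hx : x ≠ 0) (hbx : ‖b * x‖ < q) :
    coeffAC q a b c d x * phiFun q a b c d γ (x / q) +
      coeffBC q a b c d x * phiFun q a b c d γ (q * x) +
      ((sPar q a b c d)⁻¹ + sPar q a b c d - coeffAC q a b c d x - coeffBC q a b c d x) *
        phiFun q a b c d γ x = (γ + γ⁻¹) * phiFun q a b c d γ x := by
  have hnq : ‖(q : ℂ)‖ = q := by rw [Complex.norm_real, Real.norm_of_nonneg hq0.le]
  have h1 : ‖b * x‖ < 1 := hbx.trans hq1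
  have h2 : ‖b * (x / q)‖ < 1 := by
    rw [← mul_div_assoc, norm_div, hnq, div_lt_one hq0]; exact hbx
  have h3 : ‖b * (q * x)‖ < 1 := by
    rw [mul_left_comm, norm_mul, hnq]; nlinarith [norm_nonneg (b * x)]
  have hsum := (((hasSum_phiFun hq0 hq1 h γ h2).mul_left (coeffAC q a b c d x)).add
    ((hasSum_phiFun hq0 hq1 h γ h3).mul_left (coeffBC q a b c d x))).add
    ((hasSum_phiFun hq0 hq1 h γ h1).mul_left ((sPar q a b c d)⁻¹ + sPar q a b c d -
      coeffAC q a b c d x - coeffBC q a b c d x - (γ + γ⁻¹)))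
  have ht := hsum.tendsto_sum_nat.comp (tendsto_add_atTop_nat 1)
  have hzero : Tendsto (fun n : ℕ => (sPar q a b c d)⁻¹ * ((q : ℂ) ^ n)⁻¹ *
      (1 - sPar q a b c d * γ * (q : ℂ) ^ n) * (1 - sPar q a b c d / γ * (q : ℂ) ^ n) *
        (phiCoeff q a b c d γ n * phiPoly q a b n x)) atTop (𝓝 0) := by
    obtain ⟨K, -, hK⟩ := geomIncr_phiCoeff hq0 hq1 h γ
    obtain ⟨r, hr, hr1⟩ := exists_between hbx
    have hr0 : 0 < r := (norm_nonneg _).trans_lt hr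
    have hprod : Tendsto (fun n : ℕ => ((q : ℂ) ^ n)⁻¹ * phiPoly q a b n x) atTop (𝓝 0) := by
      refine squeeze_zero_norm (fun n => ?_) (summable_prod_add_geometric hq0 hq1
        (div_pos hr0 hq0) ((div_lt_one hq0).2 hr1) (norm_nonneg (b / a))).tendsto_atTop_zero
      rw [norm_mul, norm_inv, norm_ofReal_pow hq0, inv_mul_le_iff₀ (pow_pos hq0 n)]
      exact norm_phiPoly_le_pow_mul hq0 a (by rw [mul_div_cancel₀ _ hq0.ne']; exact hr.le) n
    have hpow : Tendsto (fun n : ℕ => (q : ℂ) ^ n) atTop (𝓝 0) :=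
      tendsto_pow_atTop_nhds_zero_of_norm_lt_one (by rw [hnq]; exact hq1)
    have hlim := (((hpow.const_mul (sPar q a b c d * γ)).const_sub 1).mul
      ((hpow.const_mul (sPar q a b c d / γ)).const_sub 1)).mul
      ((tendsto_phiCoeff hq0 hq1 h γ).mul hprod)
    have := hlim.const_mul (sPar q a b c d)⁻¹
    simp only [mul_zero] at this
    exact this.congr fun n => by ring
  have := tendsto_nhds_unique ht
    (hzero.congr fun n => (sum_range_operator_phiPoly hq0 hq1 h hγ hx n).symm)
  linear_combination this

/-! ### The Casorati determinant is determined by its limit at the origin -/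

theorem qPochInf_eq_zero {q : ℝ} {x : ℂ} {k : ℕ} (h : x * (q : ℂ) ^ k = 1) :
    qPochInf q x = 0 :=
  tprod_of_exists_eq_zero ⟨k, by rw [h, sub_self]⟩

/-- Up to a constant, `B(x) x² w(x)`, with the zeros of `B` cancelled against the poles of `w`. -/
def reducedWeight (q : ℝ) (a b c d x : ℂ) : ℂ :=
  qPochInf q (a * x) * qPochInf q (b * x) / (qPochInf q (c * q * x) * qPochInf q (d * q * x))

theorem tendsto_reducedWeight_zero {q : ℝ} (hq0 : 0 < q) (hq1 : q < 1) (a b c d : ℂ) :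
    Tendsto (reducedWeight q a b c d) (𝓝 0) (𝓝 1) := by
  have h : ∀ u : ℂ, Tendsto (fun x : ℂ => qPochInf q (u * x)) (𝓝 0) (𝓝 1) := by
    intro u
    have := ((continuous_qPochInf hq0 hq1).comp (continuous_const_mul u)).tendsto 0
    simpa [Function.comp_def, qPochInf_zero] using this
  have := ((h a).mul (h b)).div ((h (c * q)).mul (h (d * q))) (by simp)
  rw [mul_one, div_one] at this
  exact this

/-- One step of the recurrence for the Casorati determinant: if `W` and `W'` are its numerators at
`x` and at `qx`, then the weighted determinants agree. -/
theorem reducedWeight_step {q : ℝ} (hq0 : 0 < q) (hq1 : q < 1) {a b c d x W W' : ℂ}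
    (h : Regular q a b c d) (hx : x ≠ 0) (hcx : c * q * x ≠ 1) (hdx : d * q * x ≠ 1)
    (hW : coeffAC q a b c d (q * x) * W = coeffBC q a b c d (q * x) * W') :
    W / x * reducedWeight q a b c d x = W' / (q * x) * reducedWeight q a b c d (q * x) := by
  have hq : (q : ℂ) ≠ 0 := by exact_mod_cast hq0.ne'
  have hs := sPar_ne_zero hq0 h
  have hs2 := sPar_sq q a b c d
  have ha := h.ha; have hb := h.hb; have hc := h.hc; have hd := h.hd
  have h1 : 1 - c * q * x ≠ 0 := sub_ne_zero.2 hcx.symm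
  have h2 : 1 - d * q * x ≠ 0 := sub_ne_zero.2 hdx.symm
  have e : (1 - a * x) * (1 - b * x) * W * q = (1 - c * q * x) * (1 - d * q * x) * W' := by
    rw [coeffAC, coeffBC] at hW
    generalize sPar q a b c d = s at *
    field_simp at hW hs2
    have hk : (1 - a * x) * (1 - b * x) * W * q * (c * d * q * (x * x)) =
        (1 - c * q * x) * (1 - d * q * x) * W' * (c * d * q * (x * x)) := by
      linear_combination (x * x) * hW + (x * x) * (1 - c * q * x) * (1 - d * q * x) * W' * hs2
    exact mul_right_cancel₀ (by positivity) hk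
  rw [reducedWeight, reducedWeight, qPochInf_eq_mul hq0 hq1 (a * x),
    qPochInf_eq_mul hq0 hq1 (b * x), qPochInf_eq_mul hq0 hq1 (c * q * x),
    qPochInf_eq_mul hq0 hq1 (d * q * x), mul_left_comm a, mul_left_comm b,
    mul_left_comm (c * (q : ℂ)), mul_left_comm (d * (q : ℂ))]
  generalize qPochInf q (q * (a * x)) = X1
  generalize qPochInf q (q * (b * x)) = X2
  generalize qPochInf q (q * (c * q * x)) = X3
  generalize qPochInf q (q * (d * q * x)) = X4
  have e' : W' = (1 - a * x) * (1 - b * x) * W * q / ((1 - c * q * x) * (1 - d * q * x)) := by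
    rw [eq_div_iff (mul_ne_zero h1 h2), e]; ring
  rw [e', div_mul_div_comm, div_mul_div_comm, mul_mul_mul_comm (1 - c * q * x),
    div_mul_eq_mul_div, div_div]
  by_cases hX : X3 * X4 = 0
  · simp [hX]
  · have h3 : X3 ≠ 0 := left_ne_zero_of_mul hX
    have h4 : X4 ≠ 0 := right_ne_zero_of_mul hX
    rw [div_eq_div_iff (by simp [*]) (by simp [*])]
    ring

/-- Two solutions of the three-term recurrence along `x, qx, q²x, …`: the weighted Casorati
determinant at `x` is expressed by the limits of the solutions and of their `q`-derivatives. -/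
theorem casorati_eq_limit {q : ℝ} (hq0 : 0 < q) (hq1 : q < 1) {a b c d x μ : ℂ}
    (h : Regular q a b c d) (hx : x ≠ 0) (hcx : ∀ k : ℕ, c * q * x * (q : ℂ) ^ k ≠ 1)
    (hdx : ∀ k : ℕ, d * q * x * (q : ℂ) ^ k ≠ 1) {f g : ℕ → ℂ} {f₀ f₁ g₀ g₁ : ℂ}
    (hf : ∀ k, coeffAC q a b c d (q ^ (k + 1) * x) * f k +
      coeffBC q a b c d (q ^ (k + 1) * x) * f (k + 2) +
      ((sPar q a b c d)⁻¹ + sPar q a b c d - coeffAC q a b c d (q ^ (k + 1) * x) -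
        coeffBC q a b c d (q ^ (k + 1) * x)) * f (k + 1) = μ * f (k + 1))
    (hg : ∀ k, coeffAC q a b c d (q ^ (k + 1) * x) * g k +
      coeffBC q a b c d (q ^ (k + 1) * x) * g (k + 2) +
      ((sPar q a b c d)⁻¹ + sPar q a b c d - coeffAC q a b c d (q ^ (k + 1) * x) -
        coeffBC q a b c d (q ^ (k + 1) * x)) * g (k + 1) = μ * g (k + 1))
    (hf₀ : Tendsto f atTop (𝓝 f₀)) (hg₀ : Tendsto g atTop (𝓝 g₀))
    (hf₁ : Tendsto (fun k => (f k - f (k + 1)) / (q ^ k * x * (1 - q))) atTop (𝓝 f₁))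
    (hg₁ : Tendsto (fun k => (g k - g (k + 1)) / (q ^ k * x * (1 - q))) atTop (𝓝 g₁)) :
    (f 0 * g 1 - f 1 * g 0) / x * reducedWeight q a b c d x =
      (1 - q) * (g₀ * f₁ - f₀ * g₁) := by
  have hq : (q : ℂ) ≠ 0 := by exact_mod_cast hq0.ne'
  have hq1' : (1 - q : ℂ) ≠ 0 := sub_ne_zero.2 (by exact_mod_cast hq1.ne')
  have hxk : ∀ k : ℕ, (q : ℂ) ^ k * x ≠ 0 := fun k => mul_ne_zero (pow_ne_zero k hq) hx
  set E : ℕ → ℂ := fun k => (f k * g (k + 1) - f (k + 1) * g k) / (q ^ k * x) *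
    reducedWeight q a b c d (q ^ k * x) with hE
  have hstep : ∀ k, E (k + 1) = E k := by
    intro k
    have e : (q : ℂ) ^ (k + 1) * x = q * (q ^ k * x) := by ring
    have hfk := hf k
    have hgk := hg k
    simp only [hE]
    rw [e] at hfk hgk ⊢
    refine (reducedWeight_step hq0 hq1 h (hxk k) ?_ ?_ ?_).symm
    · rw [mul_left_comm, mul_comm]; exact hcx k
    · rw [mul_left_comm, mul_comm]; exact hdx k
    · linear_combination g (k + 1) * hfk - f (k + 1) * hgk
  have hconst : ∀ k, E k = E 0 := by
    intro k
    induction k with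
    | zero => rfl
    | succ k ih => rw [hstep, ih]
  have hy : Tendsto (fun k : ℕ => (q : ℂ) ^ k * x) atTop (𝓝 0) := by
    have : Tendsto (fun k : ℕ => (q : ℂ) ^ k) atTop (𝓝 0) :=
      tendsto_pow_atTop_nhds_zero_of_norm_lt_one
        (by rwa [Complex.norm_real, Real.norm_of_nonneg hq0.le])
    simpa using this.mul_const x
  have hlim : Tendsto E atTop (𝓝 ((1 - q) * (g₀ * f₁ - f₀ * g₁))) := by
    have := (((hg₀.mul hf₁).sub (hf₀.mul hg₁)).const_mul (1 - q : ℂ)).mul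
      ((tendsto_reducedWeight_zero hq0 hq1 a b c d).comp hy)
    rw [mul_one] at this
    refine this.congr fun k => ?_
    simp only [hE, Function.comp_apply]
    congr 1
    have := hxk k
    field_simp
    ring
  have := tendsto_nhds_unique (tendsto_const_nhds.congr fun k => (hconst k).symm) hlim
  simpa [hE] using this

/-! ### Evaluation of the Casorati determinant at the pole `x = 1/a` -/

/-- If `F` is differentiable at `0`, then its `q`-derivatives tend to `F'(0)`. -/
theorem tendsto_qDeriv_of_hasDerivAt {q : ℝ} (hq0 : 0 < q) (hq1 : q < 1) {F : ℂ → ℂ} {F' : ℂ}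
    (hF : HasDerivAt F F' 0) :
    Tendsto (fun y : ℂ => (F y - F (q * y)) / (y * (1 - q))) (𝓝[≠] 0) (𝓝 F') := by
  have hq : (q : ℂ) ≠ 0 := by exact_mod_cast hq0.ne'
  have hq1' : (1 - q : ℂ) ≠ 0 := sub_ne_zero.2 (by exact_mod_cast hq1.ne')
  have h1 : HasDerivAt (fun y : ℂ => F y - F (q * y)) (F' - F' * q) 0 := by
    have h2 : HasDerivAt (fun y : ℂ => (q : ℂ) * y) q 0 := by
      simpa using (hasDerivAt_id (0 : ℂ)).const_mul (q : ℂ)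
    have h3 : HasDerivAt F F' ((q : ℂ) * 0) := by rwa [mul_zero]
    exact hF.sub (h3.comp 0 h2)
  have h4 := (hasDerivAt_iff_tendsto_slope.1 h1).div_const (1 - q : ℂ)
  rw [show (F' - F' * q) / (1 - q : ℂ) = F' by field_simp] at h4
  refine h4.congr fun y => ?_
  simp [slope_def_field, div_div]

theorem geomIncr_telescope {q : ℝ} (hq0 : 0 < q) (hq1 : q < 1) {u : ℕ → ℂ} {L : ℂ}
    (hu : GeomIncr q u) (hL : Tendsto u atTop (𝓝 L)) : u 0 + ∑' k, (u (k + 1) - u k) = L := by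
  obtain ⟨C, -, h⟩ := hu
  have hs : Summable fun k => u (k + 1) - u k :=
    Summable.of_norm_bounded ((summable_geometric_of_lt_one hq0.le hq1).mul_left C)
      fun k => (h k).2
  have := hs.hasSum.tendsto_sum_nat
  simp only [Finset.sum_range_sub] at this
  rw [tendsto_nhds_unique this (hL.sub_const (u 0))]
  ring

/-- The Abel type limit for a series whose coefficients contain `(ρ/t;q)_k`. -/
theorem tendsto_one_sub_mul_tsum_qPoch {q : ℝ} (hq0 : 0 < q) (hq1 : q < 1) {e : ℕ → ℂ}
    (he : GeomIncr q e) (ρ : ℂ) {ω : ℂ} (hω : ‖ω‖ ≤ 1) :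
    Tendsto (fun t : ℝ => (1 - ω * t) * ∑' k, e k * qPoch q (ρ / t) k * (ω * t) ^ k) (𝓝[<] 1)
      (𝓝 (e 0 * qPoch q ρ 0 +
        ∑' k, (e (k + 1) * qPoch q ρ (k + 1) - e k * qPoch q ρ k) * ω ^ (k + 1))) := by
  obtain ⟨K, hK, he⟩ := he
  set M := Real.exp (2 * ‖ρ‖ * (1 - q)⁻¹)
  have hM : 0 < M := Real.exp_pos _
  have hρ := norm_nonneg ρ
  refine tendsto_one_sub_mul_tsum (C := K * M * (1 + 2 * ‖ρ‖)) hq0 hq1 hω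
    (c := fun k t => e k * qPoch q (ρ / t) k) (l := fun k => e k * qPoch q ρ k) ?_ ?_
  · intro t ht k
    have ht0 : (0 : ℝ) < t := by linarith [ht.1]
    have hy : ‖ρ / (t : ℂ)‖ ≤ 2 * ‖ρ‖ := by
      rw [norm_div, Complex.norm_real, Real.norm_of_nonneg ht0.le, div_le_iff₀ ht0]
      nlinarith [ht.1]
    have hb : ∀ n, ‖qPoch q (ρ / t) n‖ ≤ M := norm_qPoch_le hq0 hq1 hy
    constructor
    · rw [norm_mul]
      calc _ ≤ K * M := mul_le_mul (he k).1 (hb k) (norm_nonneg _) hK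
        _ ≤ _ := le_mul_of_one_le_right (by positivity) (by linarith)
    · have e1 : e (k + 1) * qPoch q (ρ / t) (k + 1) - e k * qPoch q (ρ / t) k =
          (e (k + 1) - e k) * qPoch q (ρ / t) k -
            e (k + 1) * (qPoch q (ρ / t) k * (ρ / t * (q : ℂ) ^ k)) := by
        rw [qPoch_succ]; ring
      change ‖e (k + 1) * qPoch q (ρ / t) (k + 1) - e k * qPoch q (ρ / t) k‖ ≤ _
      rw [e1]
      have h1 : ‖e (k + 1) - e k‖ * ‖qPoch q (ρ / t) k‖ ≤ (K * q ^ k) * M :=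
        mul_le_mul (he k).2 (hb k) (norm_nonneg _) (by positivity)
      have h2 : ‖e (k + 1)‖ * (‖qPoch q (ρ / t) k‖ * (‖ρ / (t : ℂ)‖ * q ^ k)) ≤
          K * (M * (2 * ‖ρ‖ * q ^ k)) := by
        have := (he (k + 1)).1
        have := hb k
        gcongr
      calc _ ≤ _ := norm_sub_le _ _
        _ ≤ K * q ^ k * M + K * (M * (2 * ‖ρ‖ * q ^ k)) := by
            rw [norm_mul, norm_mul (e (k + 1)), norm_mul (qPoch q (ρ / t) k), norm_mul (ρ / (t : ℂ)),
              norm_ofReal_pow hq0]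
            exact add_le_add h1 h2
        _ = _ := by ring
  · intro k
    refine Tendsto.const_mul _ ?_
    have h1 : Tendsto (fun t : ℝ => ρ / (t : ℂ)) (𝓝[<] 1) (𝓝 ρ) := by
      have h2 : Tendsto (fun t : ℝ => (t : ℂ)) (𝓝[<] 1) (𝓝 1) := by
        simpa using (Complex.continuous_ofReal.tendsto 1).mono_left nhdsWithin_le_nhds
      have := (tendsto_const_nhds (x := ρ)).div h2 one_ne_zero
      rw [div_one] at this
      exact this
    exact ((continuous_qPoch q k).tendsto ρ).comp h1

theorem coeffAC_swap (q : ℝ) (a b c d x : ℂ) : coeffAC q b a c d x = coeffAC q a b c d x := by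
  rw [coeffAC, coeffAC, sPar_swap]; ring

theorem coeffBC_swap (q : ℝ) (a b c d x : ℂ) : coeffBC q b a c d x = coeffBC q a b c d x := by
  rw [coeffBC, coeffBC, sPar_swap]

/-- The limit at the origin of the weighted Casorati determinant of the two series. -/
def casoratiZero (q : ℝ) (a b c d γ : ℂ) : ℂ :=
  (1 - q) * (phiFun q b a c d γ 0 * deriv (phiFun q a b c d γ) 0 -
    phiFun q a b c d γ 0 * deriv (phiFun q b a c d γ) 0)

theorem norm_mul_pow_lt {q : ℝ} (hq0 : 0 < q) (hq1 : q < 1) {b x : ℂ} (hx : ‖b * x‖ < 1)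
    (k : ℕ) : ‖b * ((q : ℂ) ^ (k + 1) * x)‖ < q := by
  rw [mul_left_comm, norm_mul, norm_ofReal_pow hq0, pow_succ]
  have h1 : q ^ k ≤ 1 := pow_le_one₀ hq0.le hq1.le
  have h2 : 0 < q ^ k := pow_pos hq0 k
  have h3 := norm_nonneg (b * x)
  calc q ^ k * q * ‖b * x‖ ≤ 1 * q * ‖b * x‖ := by gcongr
    _ < q := by nlinarith

theorem tendsto_pow_mul_zero {q : ℝ} (hq0 : 0 < q) (hq1 : q < 1) {x : ℂ} (hx : x ≠ 0) :
    Tendsto (fun k : ℕ => (q : ℂ) ^ k * x) atTop (𝓝[≠] 0) := by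
  have hq : (q : ℂ) ≠ 0 := by exact_mod_cast hq0.ne'
  refine tendsto_nhdsWithin_iff.2 ⟨?_, Eventually.of_forall fun k =>
    mul_ne_zero (pow_ne_zero k hq) hx⟩
  have : Tendsto (fun k : ℕ => (q : ℂ) ^ k) atTop (𝓝 0) :=
    tendsto_pow_atTop_nhds_zero_of_norm_lt_one
      (by rwa [Complex.norm_real, Real.norm_of_nonneg hq0.le])
  simpa using this.mul_const x

theorem phiFun_recurrence {q : ℝ} (hq0 : 0 < q) (hq1 : q < 1) {a b c d γ x : ℂ}
    (h : Regular q a b c d) (hγ : γ ≠ 0) (hx : x ≠ 0) (hbx : ‖b * x‖ < 1) (k : ℕ) :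
    coeffAC q a b c d (q ^ (k + 1) * x) * phiFun q a b c d γ (q ^ k * x) +
      coeffBC q a b c d (q ^ (k + 1) * x) * phiFun q a b c d γ (q ^ (k + 2) * x) +
      ((sPar q a b c d)⁻¹ + sPar q a b c d - coeffAC q a b c d (q ^ (k + 1) * x) -
        coeffBC q a b c d (q ^ (k + 1) * x)) * phiFun q a b c d γ (q ^ (k + 1) * x) =
      (γ + γ⁻¹) * phiFun q a b c d γ (q ^ (k + 1) * x) := by
  have hq : (q : ℂ) ≠ 0 := by exact_mod_cast hq0.ne'
  have := operator_phiFun hq0 hq1 h hγ (mul_ne_zero (pow_ne_zero (k + 1) hq) hx)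
    (norm_mul_pow_lt hq0 hq1 hbx k)
  rwa [show (q : ℂ) ^ (k + 1) * x / q = q ^ k * x by field_simp; ring,
    show (q : ℂ) * (q ^ (k + 1) * x) = q ^ (k + 2) * x by ring] at this

theorem tendsto_phiFun_zero {q : ℝ} (hq0 : 0 < q) (hq1 : q < 1) {a b c d x : ℂ}
    (h : Regular q a b c d) (γ : ℂ) (hx : x ≠ 0) :
    Tendsto (fun k : ℕ => phiFun q a b c d γ (q ^ k * x)) atTop (𝓝 (phiFun q a b c d γ 0)) :=
  ((differentiableAt_phiFun hq0 hq1 h γ (by simp)).continuousAt.tendsto.mono_left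
    nhdsWithin_le_nhds).comp (tendsto_pow_mul_zero hq0 hq1 hx)

theorem tendsto_qDeriv_phiFun {q : ℝ} (hq0 : 0 < q) (hq1 : q < 1) {a b c d x : ℂ}
    (h : Regular q a b c d) (γ : ℂ) (hx : x ≠ 0) :
    Tendsto (fun k : ℕ => (phiFun q a b c d γ (q ^ k * x) - phiFun q a b c d γ (q ^ (k + 1) * x)) /
      (q ^ k * x * (1 - q))) atTop (𝓝 (deriv (phiFun q a b c d γ) 0)) := by
  refine ((tendsto_qDeriv_of_hasDerivAt hq0 hq1
    (differentiableAt_phiFun hq0 hq1 h γ (x := 0) (by simp)).hasDerivAt).comp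
      (tendsto_pow_mul_zero hq0 hq1 hx)).congr fun k => ?_
  simp only [Function.comp_apply]
  rw [← mul_assoc, ← pow_succ']

theorem casorati_phiFun {q : ℝ} (hq0 : 0 < q) (hq1 : q < 1) {a b c d γ x : ℂ}
    (h : Regular q a b c d) (hγ : γ ≠ 0) (hx : x ≠ 0) (hax : ‖a * x‖ < 1) (hbx : ‖b * x‖ < 1)
    (hcx : ∀ k : ℕ, c * q * x * (q : ℂ) ^ k ≠ 1) (hdx : ∀ k : ℕ, d * q * x * (q : ℂ) ^ k ≠ 1) :
    (phiFun q a b c d γ x * phiFun q b a c d γ (q * x) -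
      phiFun q a b c d γ (q * x) * phiFun q b a c d γ x) / x * reducedWeight q a b c d x =
      casoratiZero q a b c d γ := by
  have := casorati_eq_limit hq0 hq1 h hx hcx hdx
    (f := fun k => phiFun q a b c d γ (q ^ k * x)) (g := fun k => phiFun q b a c d γ (q ^ k * x))
    (μ := γ + γ⁻¹) (phiFun_recurrence hq0 hq1 h hγ hx hbx)
    (by
      have := phiFun_recurrence hq0 hq1 h.symm hγ hx hax
      simpa only [coeffAC_swap q a b, coeffBC_swap q a b, sPar_swap q a b] using this)
    (tendsto_phiFun_zero hq0 hq1 h γ hx) (tendsto_phiFun_zero hq0 hq1 h.symm γ hx)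
    (tendsto_qDeriv_phiFun hq0 hq1 h γ hx) (tendsto_qDeriv_phiFun hq0 hq1 h.symm γ hx)
  simpa [casoratiZero] using this

theorem phiFun_eq_tsum {q : ℝ} {a : ℂ} (ha : a ≠ 0) (b c d γ : ℂ) {x : ℂ} (hx : x ≠ 0) :
    phiFun q a b c d γ x =
      ∑' k, phiCoeff q a b c d γ k * qPoch q (q / (a * x)) k * (b * x) ^ k :=
  tsum_congr fun k => by rw [mul_assoc, qPoch_mul_pow ha b hx]

theorem phiFun_q_div {q : ℝ} (a b c d γ : ℂ) : phiFun q a b c d γ (q / a) = 1 := by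
  rw [phiFun, tsum_eq_single 0]
  · simp [phiCoeff, phiPoly, qPoch_zero]
  · intro k hk
    rw [phiPoly, Finset.prod_eq_zero (Finset.mem_range.2 (Nat.pos_of_ne_zero hk)) (by ring),
      mul_zero]

/-- The factor `(sγ, s/γ;q)_∞ / (cq/a, cq/b, dq/a, dq/b;q)_∞`. -/
def casoratiFactor (q : ℝ) (a b c d γ : ℂ) : ℂ :=
  qPochInf q (sPar q a b c d * γ) * qPochInf q (sPar q a b c d / γ) /
    (qPochInf q (c * (q : ℂ) / a) * qPochInf q (c * (q : ℂ) / b) *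
      qPochInf q (d * (q : ℂ) / a) * qPochInf q (d * (q : ℂ) / b))

/-- The residue computation: as `x = t/a` tends to `1/a`, only the pole of `φ_γ^†` survives the
simple zero of the weight, and `φ_γ(q/a) = 1`. -/
theorem casoratiZero_of_norm_le {q : ℝ} (hq0 : 0 < q) (hq1 : q < 1) {a b c d γ : ℂ}
    (h : Regular q a b c d) (hγ : γ ≠ 0) (hba : ‖b‖ ≤ ‖a‖) :
    casoratiZero q a b c d γ = b * theta q (a / b) * casoratiFactor q a b c d γ := by
  have hq : (q : ℂ) ≠ 0 := by exact_mod_cast hq0.ne'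
  have hnq : ‖(q : ℂ)‖ = q := by rw [Complex.norm_real, Real.norm_of_nonneg hq0.le]
  have ha := h.ha
  have hb := h.hb
  have hω : ‖b / a‖ ≤ 1 := by rw [norm_div]; exact div_le_one_of_le₀ hba (norm_nonneg _)
  have hω1 : 1 - b / a ≠ 0 := by
    refine sub_ne_zero.2 fun h1 => h.hab ?_
    rw [eq_div_iff ha, one_mul] at h1
    exact h1
  have hev : ∀ᶠ t : ℝ in 𝓝[<] 1, t ∈ Set.Ioo (1 / 2 : ℝ) 1 := Ioo_mem_nhdsLT (by norm_num)
  have hcoe : Tendsto (fun t : ℝ => (t : ℂ)) (𝓝[<] 1) (𝓝 1) := by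
    simpa using (Complex.continuous_ofReal.tendsto 1).mono_left nhdsWithin_le_nhds
  have hP : ∀ u : ℂ, Tendsto (fun t : ℝ => qPochInf q (u * t)) (𝓝[<] 1) (𝓝 (qPochInf q u)) := by
    intro u
    have h1 := hcoe.const_mul u
    rw [mul_one] at h1
    exact ((continuous_qPochInf hq0 hq1).tendsto u).comp h1
  have hone : Tendsto (fun t : ℝ => (1 - t : ℂ)) (𝓝[<] 1) (𝓝 0) := by
    simpa using hcoe.const_sub 1
  -- `(1 - t) φ_γ(t/a) → 0`, because the singularity of `φ_γ` is at `x = 1/b`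
  have hF : Tendsto (fun t : ℝ => (1 - t : ℂ) * phiFun q a b c d γ (t / a)) (𝓝[<] 1) (𝓝 0) := by
    have h1 := tendsto_one_sub_mul_tsum_qPoch hq0 hq1 (geomIncr_phiCoeff hq0 hq1 h γ) q hω
    have h2 : Tendsto (fun t : ℝ => (1 - b / a * t : ℂ)) (𝓝[<] 1) (𝓝 (1 - b / a)) := by
      simpa using (hcoe.const_mul (b / a)).const_sub 1
    have h3 := hone.mul (h1.div h2 hω1)
    rw [zero_mul] at h3
    refine h3.congr' ?_
    filter_upwards [hev, h2.eventually_ne hω1] with t ht hne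
    have ht0 : (t : ℂ) ≠ 0 := by exact_mod_cast (by linarith [ht.1] : (0 : ℝ) < t).ne'
    rw [phiFun_eq_tsum ha b c d γ (div_ne_zero ht0 ha), mul_div_cancel₀ _ ha,
      mul_div_assoc', mul_div_right_comm, Pi.div_apply, mul_div_cancel_left₀ _ hne]
  have hG : Tendsto (fun t : ℝ => (1 - t : ℂ) * phiFun q b a c d γ (t / a)) (𝓝[<] 1)
      (𝓝 (qPochInf q (sPar q b a c d * γ) * qPochInf q (sPar q b a c d / γ) *
        ((qPochInf q (q : ℂ))⁻¹ * (qPochInf q (c * (q : ℂ) / b))⁻¹ *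
          (qPochInf q (d * (q : ℂ) / b))⁻¹) * qPochInf q (q / (b / a)))) := by
    have h1 := tendsto_one_sub_mul_tsum_qPoch hq0 hq1 (geomIncr_phiCoeff hq0 hq1 h.symm γ)
      (q / (b / a)) (ω := 1) (by simp)
    simp only [one_pow, mul_one, one_mul] at h1
    rw [geomIncr_telescope hq0 hq1 (u := fun k => phiCoeff q b a c d γ k * qPoch q (q / (b / a)) k)
      ((geomIncr_phiCoeff hq0 hq1 h.symm γ).mul hq0 (geomIncr_qPoch hq0 hq1 _))
      ((tendsto_phiCoeff hq0 hq1 h.symm γ).mul (tendsto_qPoch hq0 hq1 _))] at h1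
    refine h1.congr' ?_
    filter_upwards [hev] with t ht
    have ht0 : (t : ℂ) ≠ 0 := by exact_mod_cast (by linarith [ht.1] : (0 : ℝ) < t).ne'
    rw [phiFun_eq_tsum hb a c d γ (div_ne_zero ht0 ha), mul_div_cancel₀ _ ha, div_div,
      div_mul_eq_mul_div, mul_div_assoc' b]
  have hcont : ∀ {u v : ℂ}, Regular q u v c d → ‖v * (q / a)‖ < 1 →
      Tendsto (fun t : ℝ => phiFun q u v c d γ (q * (t / a))) (𝓝[<] 1)
        (𝓝 (phiFun q u v c d γ (q / a))) := by
    intro u v huv hv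
    refine (differentiableAt_phiFun hq0 hq1 huv γ hv).continuousAt.tendsto.comp ?_
    have := (hcoe.div_const a).const_mul (q : ℂ)
    rwa [mul_one_div] at this
  have hFq := hcont h (by
    rw [mul_div_left_comm, norm_mul, hnq]; nlinarith [norm_nonneg (b / a)])
  have hGq := hcont h.symm (by rw [mul_div_cancel₀ _ ha, hnq]; exact hq1)
  rw [phiFun_q_div] at hFq
  have hc0 := qPochInf_ne_zero hq0 hq1 h.hca
  have hd0 := qPochInf_ne_zero hq0 hq1 h.hda
  have hK := ((hP q).mul (hP (b / a))).div ((hP (c * q / a)).mul (hP (d * q / a)))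
    (mul_ne_zero hc0 hd0)
  have hlim := (((hF.mul hGq).sub (hFq.mul hG)).div hcoe one_ne_zero).mul (hK.const_mul a)
  have hE : Tendsto (fun _ : ℝ => casoratiZero q a b c d γ) (𝓝[<] 1)
      (𝓝 (casoratiZero q a b c d γ)) := tendsto_const_nhds
  have huniq := tendsto_nhds_unique hE (hlim.congr' (by
    filter_upwards [hev, (hP (c * q / a)).eventually_ne hc0, (hP (d * q / a)).eventually_ne hd0]
      with t ht hct hdt
    have htp : (0 : ℝ) < t := by linarith [ht.1]
    have ht0 : (t : ℂ) ≠ 0 := by exact_mod_cast htp.ne'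
    have hnt : ‖(t : ℂ)‖ < 1 := by
      rw [Complex.norm_real, Real.norm_of_nonneg htp.le]; exact ht.2
    have e1 : ∀ u : ℂ, u * q * (t / a) = u * q / a * t := fun u => by ring
    rw [← casorati_phiFun hq0 hq1 h hγ (x := t / a) (div_ne_zero ht0 ha)
      (by rwa [mul_div_cancel₀ _ ha])
      (by
        rw [mul_div_left_comm, norm_mul]
        nlinarith [norm_nonneg (b / a), norm_nonneg (t : ℂ)])
      (fun k hk => hct (qPochInf_eq_zero (k := k) (by rwa [← e1])))
      (fun k hk => hdt (qPochInf_eq_zero (k := k) (by rwa [← e1]))),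
      reducedWeight, e1, e1, mul_div_cancel₀ _ ha, qPochInf_eq_mul hq0 hq1 (t : ℂ),
      mul_div_left_comm b, mul_comm (t : ℂ) (b / a)]
    simp only [Pi.div_apply]
    field_simp))
  rw [huniq, casoratiFactor, sPar_swap q a b]
  have hq' := qPochInf_ne_zero hq0 hq1 (q_mul_pow_ne_one hq0 hq1)
  have hcb0 := qPochInf_ne_zero hq0 hq1 h.hcb
  have hdb0 := qPochInf_ne_zero hq0 hq1 h.hdb
  have hθ := theta_inv hq0 hq1 (div_ne_zero ha hb)
  rw [inv_div, theta] at hθ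
  have hθ' : a * (qPochInf q (b / a) * qPochInf q (q / (b / a))) = -(b * theta q (a / b)) := by
    rw [hθ]; field_simp
  generalize qPochInf q (q / (b / a)) = Y1 at *
  generalize qPochInf q (b / a) = Y2 at *
  generalize theta q (a / b) = T at *
  generalize qPochInf q (c * q / a) = Z1 at *
  generalize qPochInf q (d * q / a) = Z2 at *
  generalize qPochInf q (c * q / b) = Z3 at *
  generalize qPochInf q (d * q / b) = Z4 at *
  field_simp
  linear_combination (-(qPochInf q (sPar q a b c d * γ) * qPochInf q (sPar q a b c d / γ))) * hθ'

theorem casoratiZero_eq {q : ℝ} (hq0 : 0 < q) (hq1 : q < 1) {a b c d γ : ℂ}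
    (h : Regular q a b c d) (hγ : γ ≠ 0) :
    casoratiZero q a b c d γ = b * theta q (a / b) * casoratiFactor q a b c d γ := by
  rcases le_total ‖b‖ ‖a‖ with hba | hba
  · exact casoratiZero_of_norm_le hq0 hq1 h hγ hba
  · have h1 := casoratiZero_of_norm_le hq0 hq1 h.symm hγ hba
    have h2 : casoratiZero q b a c d γ = -casoratiZero q a b c d γ := by
      rw [casoratiZero, casoratiZero]; ring
    have h3 : casoratiFactor q b a c d γ = casoratiFactor q a b c d γ := by
      rw [casoratiFactor, casoratiFactor, sPar_swap]; congr 1; ring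
    have h4 := theta_inv hq0 hq1 (div_ne_zero h.ha h.hb)
    rw [inv_div] at h4
    rw [h2, h3, h4] at h1
    have ha := h.ha
    rw [← neg_inj, h1]
    field_simp

/-! ### Solutions of the eigenvalue equation on `ℝ_q` -/

section Rq

variable {q zp zm : ℝ}

theorem coe_iterate_shiftUp (x : Rq q zp zm) (k : ℕ) :
    ((shiftUp^[k] x : Rq q zp zm) : ℝ) = q ^ k * x := by
  induction k with
  | zero => simp
  | succ k ih =>
    rw [Function.iterate_succ_apply']
    simp only [shiftUp, ih]
    ring

theorem Rq.ne_zero (hq0 : 0 < q) (hzp : 0 < zp) (hzm : zm < 0) (x : Rq q zp zm) :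
    (x : ℝ) ≠ 0 := by
  obtain ⟨n, hn | hn⟩ := x.2
  · rw [hn]; exact mul_ne_zero hzm.ne (zpow_ne_zero n hq0.ne')
  · rw [hn]; exact mul_ne_zero hzp.ne' (zpow_ne_zero n hq0.ne')

theorem shiftUp_shiftDown (hq0 : 0 < q) (x : Rq q zp zm) : shiftUp (shiftDown x) = x := by
  apply Subtype.ext
  simp only [shiftUp, shiftDown]
  field_simp

theorem shiftDown_shiftUp (hq0 : 0 < q) (x : Rq q zp zm) : shiftDown (shiftUp x) = x := by
  apply Subtype.ext
  simp only [shiftUp, shiftDown]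
  field_simp

/-- The two one-sided limits at `0` describe the behaviour along every orbit of `x ↦ qx`. -/
theorem contAtZero_iff (hq0 : 0 < q) {f : Rq q zp zm → ℂ} :
    ContAtZero f ↔ ∃ l, ∀ x, Tendsto (fun k : ℕ => f (shiftUp^[k] x)) atTop (𝓝 l) := by
  constructor
  · rintro ⟨l, hm, hp⟩
    refine ⟨l, fun x => ?_⟩
    obtain ⟨n, hn⟩ := x.2
    have htop : Tendsto (fun k : ℕ => (n + k).toNat) atTop atTop :=
      tendsto_atTop.2 fun m => by
        filter_upwards [eventually_ge_atTop (m + n.natAbs)] with k hk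
        omega
    have hpow : ∀ k : ℕ, 0 ≤ n + k → ∀ z : ℝ, (x : ℝ) = z * q ^ n →
        ((shiftUp^[k] x : Rq q zp zm) : ℝ) = z * q ^ (((n + k).toNat : ℕ) : ℤ) := by
      intro k hk z hz
      rw [coe_iterate_shiftUp, hz, Int.toNat_of_nonneg hk, zpow_add₀ hq0.ne', zpow_natCast]
      ring
    have hev : ∀ᶠ k : ℕ in atTop, 0 ≤ n + k := by
      filter_upwards [eventually_ge_atTop n.natAbs] with k hk
      omega
    rcases hn with hn | hn
    · refine (hm.comp htop).congr' ?_
      filter_upwards [hev] with k hk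
      exact congrArg f (Subtype.ext (hpow k hk zm hn).symm)
    · refine (hp.comp htop).congr' ?_
      filter_upwards [hev] with k hk
      exact congrArg f (Subtype.ext (hpow k hk zp hn).symm)
  · rintro ⟨l, h⟩
    refine ⟨l, (h (ptMinus q zp zm 0)).congr fun k => ?_, (h (ptPlus q zp zm 0)).congr fun k => ?_⟩
    · refine congrArg f (Subtype.ext ?_)
      rw [coe_iterate_shiftUp]
      simp [ptMinus, mul_comm]
    · refine congrArg f (Subtype.ext ?_)
      rw [coe_iterate_shiftUp]
      simp [ptPlus, mul_comm]

theorem opL_apply_iterate (hq0 : 0 < q) {a b c d μ : ℂ} {f : Rq q zp zm → ℂ}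
    (hf : opL q zp zm a b c d f = μ • f) (x : Rq q zp zm) (k : ℕ) :
    coeffAC q a b c d (q ^ (k + 1) * (x : ℝ)) * f (shiftUp^[k] x) +
      coeffBC q a b c d (q ^ (k + 1) * (x : ℝ)) * f (shiftUp^[k + 2] x) +
      ((sPar q a b c d)⁻¹ + sPar q a b c d - coeffAC q a b c d (q ^ (k + 1) * (x : ℝ)) -
        coeffBC q a b c d (q ^ (k + 1) * (x : ℝ))) * f (shiftUp^[k + 1] x) =
      μ * f (shiftUp^[k + 1] x) := by
  have h := congrFun hf (shiftUp^[k + 1] x)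
  have e1 : shiftDown (shiftUp^[k + 1] x) = shiftUp^[k] x := by
    rw [Function.iterate_succ_apply', shiftDown_shiftUp hq0]
  have e2 : shiftUp (shiftUp^[k + 1] x) = shiftUp^[k + 2] x :=
    (Function.iterate_succ_apply' _ _ _).symm
  simp only [opL, LinearMap.coe_mk, AddHom.coe_mk, Pi.smul_apply, smul_eq_mul, e1, e2, coeffC,
    coeffA, coeffB, coe_iterate_shiftUp, Complex.ofReal_mul, Complex.ofReal_pow] at h
  exact h

/-- The Casorati determinant of two elements of an eigenspace is constant on `ℝ_q`, and is given
by the values and derivatives at `0`. -/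
theorem casorati_eq (hq0 : 0 < q) (hq1 : q < 1) (hzp : 0 < zp) (hzm : zm < 0) {a b c d μ : ℂ}
    (h : Regular q a b c d) (hc : ∀ x : Rq q zp zm, c * ((x : ℝ) : ℂ) ≠ 1)
    (hd : ∀ x : Rq q zp zm, d * ((x : ℝ) : ℂ) ≠ 1) {f g : Rq q zp zm → ℂ} {f₀ f₁ g₀ g₁ : ℂ}
    (hf : opL q zp zm a b c d f = μ • f) (hg : opL q zp zm a b c d g = μ • g)
    (hf₀ : ∀ x, Tendsto (fun k : ℕ => f (shiftUp^[k] x)) atTop (𝓝 f₀))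
    (hg₀ : ∀ x, Tendsto (fun k : ℕ => g (shiftUp^[k] x)) atTop (𝓝 g₀))
    (hf₁ : ∀ x, Tendsto (fun k : ℕ => qDeriv f (shiftUp^[k] x)) atTop (𝓝 f₁))
    (hg₁ : ∀ x, Tendsto (fun k : ℕ => qDeriv g (shiftUp^[k] x)) atTop (𝓝 g₁))
    (x : Rq q zp zm) :
    casorati q zp zm a b c d f g x =
      (1 - q) * sPar q a b c d / (c * d) * ((1 - q) * (g₀ * f₁ - f₀ * g₁)) := by
  have hq : (q : ℂ) ≠ 0 := by exact_mod_cast hq0.ne'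
  have hq1' : (1 - q : ℂ) ≠ 0 := sub_ne_zero.2 (by exact_mod_cast hq1.ne')
  have hx : ((x : ℝ) : ℂ) ≠ 0 := by exact_mod_cast Rq.ne_zero hq0 hzp hzm x
  have hshift : ∀ {e : ℂ}, (∀ x : Rq q zp zm, e * ((x : ℝ) : ℂ) ≠ 1) →
      ∀ k : ℕ, e * q * ((x : ℝ) : ℂ) * (q : ℂ) ^ k ≠ 1 := by
    intro e he k hk
    refine he (shiftUp^[k + 1] x) ?_
    rw [coe_iterate_shiftUp, ← hk]
    push_cast
    ring
  have hD : ∀ {u : Rq q zp zm → ℂ} {l : ℂ},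
      Tendsto (fun k : ℕ => qDeriv u (shiftUp^[k] x)) atTop (𝓝 l) →
      Tendsto (fun k : ℕ => (u (shiftUp^[k] x) - u (shiftUp^[k + 1] x)) /
        ((q : ℂ) ^ k * ((x : ℝ) : ℂ) * (1 - q))) atTop (𝓝 l) := by
    intro u l hu
    refine hu.congr fun k => ?_
    rw [qDeriv, coe_iterate_shiftUp, ← Function.iterate_succ_apply' shiftUp]
    push_cast
    rfl
  have key := casorati_eq_limit hq0 hq1 h hx (hshift hc) (hshift hd)
    (f := fun k => f (shiftUp^[k] x)) (g := fun k => g (shiftUp^[k] x))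
    (opL_apply_iterate hq0 hf x) (opL_apply_iterate hq0 hg x) (hf₀ x) (hg₀ x)
    (hD (hf₁ x)) (hD (hg₁ x))
  simp only [Function.iterate_zero_apply, Function.iterate_one] at key
  rw [← key, casorati, uFun, weight, reducedWeight, coeffB,
    qPochInf_eq_mul hq0 hq1 (c * ((x : ℝ) : ℂ)), qPochInf_eq_mul hq0 hq1 (d * ((x : ℝ) : ℂ))]
  rw [show (q : ℂ) * (c * ((x : ℝ) : ℂ)) = c * q * ((x : ℝ) : ℂ) by ring,
    show (q : ℂ) * (d * ((x : ℝ) : ℂ)) = d * q * ((x : ℝ) : ℂ) by ring]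
  have h1 : 1 - c * ((x : ℝ) : ℂ) ≠ 0 := sub_ne_zero.2 (hc x).symm
  have h2 : 1 - d * ((x : ℝ) : ℂ) ≠ 0 := sub_ne_zero.2 (hd x).symm
  have hc0 := h.hc
  have hd0 := h.hd
  have e1 : 1 - 1 / (c * ((x : ℝ) : ℂ)) = -(1 - c * ((x : ℝ) : ℂ)) / (c * ((x : ℝ) : ℂ)) := by
    field_simp; ring
  have e2 : 1 - 1 / (d * ((x : ℝ) : ℂ)) = -(1 - d * ((x : ℝ) : ℂ)) / (d * ((x : ℝ) : ℂ)) := by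
    field_simp; ring
  rw [e1, e2]
  generalize 1 - c * ((x : ℝ) : ℂ) = y1 at *
  generalize 1 - d * ((x : ℝ) : ℂ) = y2 at *
  have h3 := qPochInf_ne_zero hq0 hq1 (hshift hc)
  have h4 := qPochInf_ne_zero hq0 hq1 (hshift hd)
  generalize qPochInf q (c * q * ((x : ℝ) : ℂ)) = X3 at *
  generalize qPochInf q (d * q * ((x : ℝ) : ℂ)) = X4 at *
  generalize ((x : ℝ) : ℂ) = z at *
  field_simp

/-- The condition `e ∉ z₊⁻¹ q^ℤ ∪ z₋⁻¹ q^ℤ` says that `1/e` is not a point of `ℝ_q`. -/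
theorem mul_coe_ne_one {e : ℂ}
    (he : ∀ n : ℤ, e ≠ ((zp⁻¹ * q ^ n : ℝ) : ℂ) ∧ e ≠ ((zm⁻¹ * q ^ n : ℝ) : ℂ))
    (x : Rq q zp zm) : e * ((x : ℝ) : ℂ) ≠ 1 := by
  intro h
  have h1 : e = (((x : ℝ)⁻¹ : ℝ) : ℂ) := by
    rw [Complex.ofReal_inv]; exact eq_inv_of_mul_eq_one_left h
  obtain ⟨n, hn | hn⟩ := x.2
  · exact (he (-n)).2 (by rw [h1, hn, mul_inv, zpow_neg])
  · exact (he (-n)).1 (by rw [h1, hn, mul_inv, zpow_neg])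

theorem coeffA_ne_zero (hq0 : 0 < q) (hzp : 0 < zp) (hzm : zm < 0) {a b c d : ℂ}
    (h : Regular q a b c d) (ha : ∀ x : Rq q zp zm, a * ((x : ℝ) : ℂ) ≠ 1)
    (hb : ∀ x : Rq q zp zm, b * ((x : ℝ) : ℂ) ≠ 1) (x : Rq q zp zm) :
    coeffA q a b c d x ≠ 0 := by
  have hq : (q : ℂ) ≠ 0 := by exact_mod_cast hq0.ne'
  have hx : ((x : ℝ) : ℂ) ≠ 0 := by exact_mod_cast Rq.ne_zero hq0 hzp hzm x
  have hfac : ∀ {e : ℂ}, e ≠ 0 → (∀ x : Rq q zp zm, e * ((x : ℝ) : ℂ) ≠ 1) →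
      1 - (q : ℂ) / (e * ((x : ℝ) : ℂ)) ≠ 0 := by
    intro e he0 he h1
    refine he (shiftDown x) ?_
    rw [sub_eq_zero, eq_div_iff (mul_ne_zero he0 hx), one_mul] at h1
    simp only [shiftDown, Complex.ofReal_mul, Complex.ofReal_inv]
    rw [mul_left_comm, h1, inv_mul_cancel₀ hq]
  exact mul_ne_zero (mul_ne_zero (inv_ne_zero (sPar_ne_zero hq0 h)) (hfac h.ha ha))
    (hfac h.hb hb)

theorem abs_lt_iff_norm_mul_lt {b : ℂ} (hb : b ≠ 0) (x : ℝ) :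
    |x| < 1 / ‖b‖ ↔ ‖b * (x : ℂ)‖ < 1 := by
  rw [lt_div_iff₀ (norm_pos_iff.2 hb), norm_mul, Complex.norm_real, Real.norm_eq_abs, mul_comm]

theorem bigqJacobi_eq_phiFun (hq0 : 0 < q) (hzp : 0 < zp) (hzm : zm < 0) {a b : ℂ} (ha : a ≠ 0)
    (hb : b ≠ 0) (c d γ : ℂ) {x : Rq q zp zm} (hx : ‖b * ((x : ℝ) : ℂ)‖ < 1) :
    bigqJacobi q zp zm a b c d γ x = phiFun q a b c d γ ((x : ℝ) : ℂ) := by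
  rw [bigqJacobi_eq_series a b c d γ x ((abs_lt_iff_norm_mul_lt hb x).2 hx),
    phiSeries_eq_phiFun ha b c d γ (Rq.ne_zero hq0 hzp hzm x)]

theorem opL_bigqJacobi (hq0 : 0 < q) (hq1 : q < 1) (hzp : 0 < zp) (hzm : zm < 0)
    {a b c d γ : ℂ} (h : Regular q a b c d) (hγ : γ ≠ 0)
    (ha : ∀ x : Rq q zp zm, a * ((x : ℝ) : ℂ) ≠ 1)
    (hb : ∀ x : Rq q zp zm, b * ((x : ℝ) : ℂ) ≠ 1) :
    opL q zp zm a b c d (bigqJacobi q zp zm a b c d γ) =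
      eigenvalue γ • bigqJacobi q zp zm a b c d γ := by
  have hnq : ‖(q : ℂ)‖ = q := by rw [Complex.norm_real, Real.norm_of_nonneg hq0.le]
  have hq : (q : ℂ) ≠ 0 := by exact_mod_cast hq0.ne'
  funext x
  simp only [opL, LinearMap.coe_mk, AddHom.coe_mk, Pi.smul_apply, smul_eq_mul]
  by_cases hx : |((shiftDown x : Rq q zp zm) : ℝ)| < 1 / ‖b‖
  · have h1 : ‖b * (((shiftDown x : Rq q zp zm) : ℝ) : ℂ)‖ < 1 :=
      (abs_lt_iff_norm_mul_lt h.hb _).1 hx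
    have e1 : (((shiftDown x : Rq q zp zm) : ℝ) : ℂ) = ((x : ℝ) : ℂ) / q := by
      simp [shiftDown, div_eq_inv_mul]
    have e2 : (((shiftUp x : Rq q zp zm) : ℝ) : ℂ) = q * ((x : ℝ) : ℂ) := by
      simp [shiftUp]
    have h2 : ‖b * ((x : ℝ) : ℂ)‖ < q := by
      rw [e1, mul_div_assoc', norm_div, hnq, div_lt_one hq0] at h1
      exact h1
    have h3 : ‖b * (((shiftUp x : Rq q zp zm) : ℝ) : ℂ)‖ < 1 := by
      rw [e2, mul_left_comm, norm_mul, hnq]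
      nlinarith [norm_nonneg (b * ((x : ℝ) : ℂ))]
    rw [bigqJacobi_eq_phiFun hq0 hzp hzm h.ha h.hb c d γ h1,
      bigqJacobi_eq_phiFun hq0 hzp hzm h.ha h.hb c d γ h3,
      bigqJacobi_eq_phiFun hq0 hzp hzm h.ha h.hb c d γ (h2.trans hq1), e1, e2]
    exact operator_phiFun hq0 hq1 h hγ
      (by exact_mod_cast Rq.ne_zero hq0 hzp hzm x) h2
  · have h1 := bigqJacobi_recurrence hq0 hq1 a h.hb c d γ (shiftDown x) hx
    rw [shiftUp_shiftDown hq0, eq_div_iff (coeffA_ne_zero hq0 hzp hzm h ha hb x)] at h1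
    linear_combination h1

theorem tendsto_bigqJacobi (hq0 : 0 < q) (hq1 : q < 1) (hzp : 0 < zp) (hzm : zm < 0)
    {a b c d : ℂ} (h : Regular q a b c d) (γ : ℂ) (x : Rq q zp zm) :
    Tendsto (fun k : ℕ => bigqJacobi q zp zm a b c d γ (shiftUp^[k] x)) atTop
        (𝓝 (phiFun q a b c d γ 0)) ∧
      Tendsto (fun k : ℕ => qDeriv (bigqJacobi q zp zm a b c d γ) (shiftUp^[k] x)) atTop
        (𝓝 (deriv (phiFun q a b c d γ) 0)) := by
  have hx : ((x : ℝ) : ℂ) ≠ 0 := by exact_mod_cast Rq.ne_zero hq0 hzp hzm x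
  have hev : ∀ᶠ k : ℕ in atTop, bigqJacobi q zp zm a b c d γ (shiftUp^[k] x) =
      phiFun q a b c d γ (q ^ k * ((x : ℝ) : ℂ)) := by
    have h1 : Tendsto (fun k : ℕ => ‖b * ((q : ℂ) ^ k * ((x : ℝ) : ℂ))‖) atTop (𝓝 0) := by
      simpa using (((tendsto_pow_mul_zero hq0 hq1 hx).mono_right
        nhdsWithin_le_nhds).const_mul b).norm
    filter_upwards [h1.eventually_lt_const one_pos] with k hk
    have e : (((shiftUp^[k] x : Rq q zp zm) : ℝ) : ℂ) = (q : ℂ) ^ k * ((x : ℝ) : ℂ) := by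
      rw [coe_iterate_shiftUp]; push_cast; rfl
    rw [← e] at hk ⊢
    exact bigqJacobi_eq_phiFun hq0 hzp hzm h.ha h.hb c d γ hk
  refine ⟨(tendsto_phiFun_zero hq0 hq1 h γ hx).congr' (hev.mono fun k hk => hk.symm),
    (tendsto_qDeriv_phiFun hq0 hq1 h γ hx).congr' ?_⟩
  filter_upwards [hev, (tendsto_add_atTop_nat 1).eventually hev] with k hk hk'
  rw [qDeriv, ← Function.iterate_succ_apply' shiftUp, hk, hk', coe_iterate_shiftUp]
  push_cast
  rfl

theorem opL_swap (a b c d : ℂ) : opL q zp zm b a c d = opL q zp zm a b c d := by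
  ext f x
  simp only [opL, LinearMap.coe_mk, AddHom.coe_mk, coeffC, coeffA, coeffB, sPar_swap q a b]
  ring

end Rq

/-! ### The parameter domain -/

theorem PairDomain.ne_zero {q zp zm : ℝ} (hq0 : 0 < q) (hzp : 0 < zp) (hzm : zm < 0) {α β : ℂ}
    (h : (α, β) ∈ PairDomain q zp zm) (hne : α ≠ β) : α ≠ 0 ∧ β ≠ 0 := by
  obtain ⟨-, -, h | ⟨x, y, rfl, rfl, k, h1, h2, h3⟩ | ⟨x, y, rfl, rfl, k, h1, h2, h3⟩⟩ := h
  · dsimp only at h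
    subst h
    have : β ≠ 0 := by rintro rfl; simp at hne
    exact ⟨by simpa using this, this⟩
  · have hp : 0 < zp * q ^ k := mul_pos hzp (zpow_pos hq0 k)
    have hy : 0 < y := inv_pos.1 (hp.trans h1)
    have hx : 0 < x := inv_pos.1 ((hp.trans h1).trans h2)
    exact ⟨by exact_mod_cast hx.ne', by exact_mod_cast hy.ne'⟩
  · have hp : zm * q ^ k < 0 := mul_neg_of_neg_of_pos hzm (zpow_pos hq0 k)
    have hy : y < 0 := inv_lt_zero.1 (h3.trans hp)
    have hx : x < 0 := inv_lt_zero.1 ((h2.trans h3).trans hp)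
    exact ⟨by exact_mod_cast hx.ne, by exact_mod_cast hy.ne⟩

/-- In the conjugate case `|α/β| = 1`; in the two real cases `α/β` lies strictly between `1` and a
neighbouring power of `q`. -/
theorem PairDomain.div_ne_zpow {q zp zm : ℝ} (hq0 : 0 < q) (hq1 : q < 1) (hzp : 0 < zp)
    (hzm : zm < 0) {α β : ℂ} (h : (α, β) ∈ PairDomain q zp zm) (hne : α ≠ β) (n : ℤ) :
    α / β ≠ (q : ℂ) ^ n := by
  obtain ⟨hα, hβ⟩ := PairDomain.ne_zero hq0 hzp hzm h hne
  intro hn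
  obtain ⟨-, -, h | ⟨x, y, rfl, rfl, k, h1, h2, h3⟩ | ⟨x, y, rfl, rfl, k, h1, h2, h3⟩⟩ := h
  · dsimp only at h
    have h1 : ‖α / β‖ = 1 := by
      rw [norm_div, h, RCLike.norm_conj, div_self (norm_ne_zero_iff.2 hβ)]
    rw [hn, norm_zpow, Complex.norm_real, Real.norm_of_nonneg hq0.le,
      zpow_eq_one_iff_right₀ hq0.le hq1.ne] at h1
    rw [h1, zpow_zero, div_eq_one_iff_eq hβ] at hn
    exact hne hn
  · have hp : 0 < zp * q ^ k := mul_pos hzp (zpow_pos hq0 k)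
    have hy : 0 < y := inv_pos.1 (hp.trans h1)
    have hx : 0 < x := inv_pos.1 ((hp.trans h1).trans h2)
    have hr : x / y = q ^ n := by exact_mod_cast hn
    have hxy : x < y := (inv_lt_inv₀ hy hx).1 h2
    have h4 : x / y < q ^ (0 : ℤ) := by rwa [zpow_zero, div_lt_one hy]
    have h5 : q ^ (1 : ℤ) < x / y := by
      rw [zpow_sub_one₀ hq0.ne', ← mul_assoc] at h3
      have h6 : x⁻¹ < y⁻¹ * q⁻¹ := h3.trans (by gcongr)
      rw [zpow_one, lt_div_iff₀ hy]
      rw [← mul_inv, inv_lt_inv₀ hx (by positivity)] at h6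
      linarith
    rw [hr] at h4 h5
    have := (zpow_lt_zpow_iff_right_of_lt_one₀ hq0 hq1).1 h4
    have := (zpow_lt_zpow_iff_right_of_lt_one₀ hq0 hq1).1 h5
    omega
  · have hp : zm * q ^ k < 0 := mul_neg_of_neg_of_pos hzm (zpow_pos hq0 k)
    have hy : y < 0 := inv_lt_zero.1 (h3.trans hp)
    have hx : x < 0 := inv_lt_zero.1 ((h2.trans h3).trans hp)
    have hr : x / y = q ^ n := by exact_mod_cast hn
    have hxy : y < x := (inv_lt_inv_of_neg hx hy).1 h2
    have h4 : x / y < q ^ (0 : ℤ) := by rwa [zpow_zero, div_lt_one_of_neg hy]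
    have h5 : q ^ (1 : ℤ) < x / y := by
      rw [zpow_sub_one₀ hq0.ne', ← mul_assoc] at h1
      have h6 : y⁻¹ * q⁻¹ < x⁻¹ := lt_trans (by gcongr) h1
      rw [zpow_one, lt_div_iff_of_neg hy]
      rw [← mul_inv, inv_lt_inv_of_neg (mul_neg_of_neg_of_pos hy hq0) hx] at h6
      linarith
    rw [hr] at h4 h5
    have := (zpow_lt_zpow_iff_right_of_lt_one₀ hq0 hq1).1 h4
    have := (zpow_lt_zpow_iff_right_of_lt_one₀ hq0 hq1).1 h5
    omega

theorem regular_of_pairDomain {q zp zm : ℝ} (hq0 : 0 < q) (hzp : 0 < zp) (hzm : zm < 0)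
    {a b c d : ℂ} (hab : (a, b) ∈ PairDomain q zp zm) (hcd : (c, d) ∈ PairDomain q zp zm)
    (h1 : a ≠ b) (h2 : c ≠ d)
    (h : ∀ n : ℤ, c / a ≠ (q : ℂ) ^ n ∧ c / b ≠ (q : ℂ) ^ n ∧ d / a ≠ (q : ℂ) ^ n ∧
      d / b ≠ (q : ℂ) ^ n) : Regular q a b c d := by
  obtain ⟨ha, hb⟩ := PairDomain.ne_zero hq0 hzp hzm hab h1
  obtain ⟨hc, hd⟩ := PairDomain.ne_zero hq0 hzp hzm hcd h2
  have hq : (q : ℂ) ≠ 0 := by exact_mod_cast hq0.ne'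
  have key : ∀ {u v : ℂ}, (∀ n : ℤ, u / v ≠ (q : ℂ) ^ n) →
      ∀ k : ℕ, u * (q : ℂ) / v * (q : ℂ) ^ k ≠ 1 := by
    intro u v huv k hk
    refine huv (-(k + 1)) ?_
    rw [zpow_neg, zpow_add_one₀ hq, zpow_natCast]
    refine eq_inv_of_mul_eq_one_left ?_
    rw [← hk]
    ring
  exact ⟨ha, hb, hc, hd, h1, key fun n => (h n).1, key fun n => (h n).2.2.1,
    key fun n => (h n).2.1, key fun n => (h n).2.2.2⟩

theorem casoratiFactor_ne_zero {q : ℝ} (hq0 : 0 < q) (hq1 : q < 1) {a b c d γ : ℂ}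
    (h : Regular q a b c d) (hγ : γ ≠ 0) (hS : γ ∉ Spol q a b c d) :
    casoratiFactor q a b c d γ ≠ 0 := by
  have hq : (q : ℂ) ≠ 0 := by exact_mod_cast hq0.ne'
  have hs := sPar_ne_zero hq0 h
  refine div_ne_zero (mul_ne_zero (qPochInf_ne_zero hq0 hq1 fun k hk => hS ⟨k, Or.inr ?_⟩)
    (qPochInf_ne_zero hq0 hq1 fun k hk => hS ⟨k, Or.inl ?_⟩))
    (mul_ne_zero (mul_ne_zero (mul_ne_zero (qPochInf_ne_zero hq0 hq1 h.hca)
      (qPochInf_ne_zero hq0 hq1 h.hcb)) (qPochInf_ne_zero hq0 hq1 h.hda))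
      (qPochInf_ne_zero hq0 hq1 h.hdb))
  · rw [← mul_inv]
    refine eq_inv_of_mul_eq_one_left ?_
    rw [← hk]
    ring
  · rw [div_mul_eq_mul_div, div_eq_one_iff_eq hγ] at hk
    exact hk.symm

/-! ### The eigenspace and its basis -/

section Eigenspace

variable {q zp zm : ℝ}

theorem bigqJacobi_mem (hq0 : 0 < q) (hq1 : q < 1) (hzp : 0 < zp) (hzm : zm < 0)
    {a b c d γ : ℂ} (h : Regular q a b c d) (hγ : γ ≠ 0)
    (ha : ∀ x : Rq q zp zm, a * ((x : ℝ) : ℂ) ≠ 1)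
    (hb : ∀ x : Rq q zp zm, b * ((x : ℝ) : ℂ) ≠ 1) :
    bigqJacobi q zp zm a b c d γ ∈ eigenspaceV q zp zm a b c d (eigenvalue γ) :=
  ⟨opL_bigqJacobi hq0 hq1 hzp hzm h hγ ha hb,
    (contAtZero_iff hq0).2 ⟨_, fun x => (tendsto_bigqJacobi hq0 hq1 hzp hzm h γ x).1⟩,
    (contAtZero_iff hq0).2 ⟨_, fun x => (tendsto_bigqJacobi hq0 hq1 hzp hzm h γ x).2⟩⟩

theorem bigqJacobiDagger_mem (hq0 : 0 < q) (hq1 : q < 1) (hzp : 0 < zp) (hzm : zm < 0)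
    {a b c d γ : ℂ} (h : Regular q a b c d) (hγ : γ ≠ 0)
    (ha : ∀ x : Rq q zp zm, a * ((x : ℝ) : ℂ) ≠ 1)
    (hb : ∀ x : Rq q zp zm, b * ((x : ℝ) : ℂ) ≠ 1) :
    bigqJacobiDagger q zp zm a b c d γ ∈ eigenspaceV q zp zm a b c d (eigenvalue γ) := by
  obtain ⟨h1, h2, h3⟩ := bigqJacobi_mem hq0 hq1 hzp hzm h.symm hγ hb ha
  rw [opL_swap] at h1
  exact ⟨h1, h2, h3⟩

theorem exists_casorati_eq (hq0 : 0 < q) (hq1 : q < 1) (hzp : 0 < zp) (hzm : zm < 0)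
    {a b c d μ : ℂ} (h : Regular q a b c d) (hc : ∀ x : Rq q zp zm, c * ((x : ℝ) : ℂ) ≠ 1)
    (hd : ∀ x : Rq q zp zm, d * ((x : ℝ) : ℂ) ≠ 1) {f g : Rq q zp zm → ℂ}
    (hf : f ∈ eigenspaceV q zp zm a b c d μ) (hg : g ∈ eigenspaceV q zp zm a b c d μ) :
    ∃ K : ℂ, ∀ x, casorati q zp zm a b c d f g x = K := by
  obtain ⟨hf, hf₀, hf₁⟩ := hf
  obtain ⟨hg, hg₀, hg₁⟩ := hg
  obtain ⟨f₀, hf₀⟩ := (contAtZero_iff hq0).1 hf₀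
  obtain ⟨f₁, hf₁⟩ := (contAtZero_iff hq0).1 hf₁
  obtain ⟨g₀, hg₀⟩ := (contAtZero_iff hq0).1 hg₀
  obtain ⟨g₁, hg₁⟩ := (contAtZero_iff hq0).1 hg₁
  exact ⟨_, casorati_eq hq0 hq1 hzp hzm h hc hd hf hg hf₀ hg₀ hf₁ hg₁⟩

theorem casorati_bigqJacobi (hq0 : 0 < q) (hq1 : q < 1) (hzp : 0 < zp) (hzm : zm < 0)
    {a b c d γ : ℂ} (h : Regular q a b c d) (hγ : γ ≠ 0)
    (ha : ∀ x : Rq q zp zm, a * ((x : ℝ) : ℂ) ≠ 1)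
    (hb : ∀ x : Rq q zp zm, b * ((x : ℝ) : ℂ) ≠ 1)
    (hc : ∀ x : Rq q zp zm, c * ((x : ℝ) : ℂ) ≠ 1)
    (hd : ∀ x : Rq q zp zm, d * ((x : ℝ) : ℂ) ≠ 1) (x : Rq q zp zm) :
    casorati q zp zm a b c d (bigqJacobi q zp zm a b c d γ)
        (bigqJacobiDagger q zp zm a b c d γ) x =
      (1 - q) * q / (a * sPar q a b c d) * (theta q (a / b) * casoratiFactor q a b c d γ) := by
  have hφ := fun x => tendsto_bigqJacobi hq0 hq1 hzp hzm h γ x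
  have hψ := fun x => tendsto_bigqJacobi hq0 hq1 hzp hzm h.symm γ x
  rw [casorati_eq hq0 hq1 hzp hzm h hc hd (bigqJacobi_mem hq0 hq1 hzp hzm h hγ ha hb).1
    (bigqJacobiDagger_mem hq0 hq1 hzp hzm h hγ ha hb).1 (fun x => (hφ x).1) (fun x => (hψ x).1)
    (fun x => (hφ x).2) (fun x => (hψ x).2) x]
  have h1 := casoratiZero_eq hq0 hq1 h hγ
  rw [casoratiZero] at h1
  rw [h1]
  have hs := sPar_ne_zero hq0 h
  have hs2 := sPar_sq q a b c d
  have ha := h.ha; have hb := h.hb; have hc := h.hc; have hd := h.hd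
  generalize theta q (a / b) = T at *
  generalize casoratiFactor q a b c d γ = R at *
  generalize sPar q a b c d = s at *
  rw [eq_div_iff (mul_ne_zero ha hb)] at hs2
  field_simp
  linear_combination T * R * (1 - q) * hs2

/-- Cramer's rule for the Casorati determinant. -/
theorem casorati_cramer (a b c d : ℂ) (f φ ψ : Rq q zp zm → ℂ) (x : Rq q zp zm) :
    casorati q zp zm a b c d φ ψ x * f x =
      casorati q zp zm a b c d f ψ x * φ x + casorati q zp zm a b c d φ f x * ψ x := by
  simp only [casorati]
  ring

/-- A Casorati determinant that is a nonzero constant makes a pair of solutions a basis. -/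
theorem exists_basis_of_casorati_ne_zero (hq0 : 0 < q) (hq1 : q < 1) (hzp : 0 < zp)
    (hzm : zm < 0) {a b c d μ : ℂ} (h : Regular q a b c d)
    (hc : ∀ x : Rq q zp zm, c * ((x : ℝ) : ℂ) ≠ 1)
    (hd : ∀ x : Rq q zp zm, d * ((x : ℝ) : ℂ) ≠ 1) {φ ψ : Rq q zp zm → ℂ}
    (hφ : φ ∈ eigenspaceV q zp zm a b c d μ) (hψ : ψ ∈ eigenspaceV q zp zm a b c d μ) {K : ℂ}
    (hK : K ≠ 0) (hD : ∀ x, casorati q zp zm a b c d φ ψ x = K) :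
    ∃ e : Module.Basis (Fin 2) ℂ (eigenspaceV q zp zm a b c d μ),
      (e 0 : Rq q zp zm → ℂ) = φ ∧ (e 1 : Rq q zp zm → ℂ) = ψ := by
  set v : Fin 2 → eigenspaceV q zp zm a b c d μ := ![⟨φ, hφ⟩, ⟨ψ, hψ⟩] with hv
  have hli : LinearIndependent ℂ v := by
    rw [LinearIndependent.pair_iff]
    intro s t hst
    have hst' : ∀ x, s * φ x + t * ψ x = 0 := fun x => congrFun (congrArg Subtype.val hst) x
    set x := ptPlus q zp zm 0
    have h0 := hst' x
    have h1 := hst' (shiftUp x)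
    have hKx := hD x
    rw [casorati] at hKx
    constructor
    · refine (mul_eq_zero.1 (?_ : s * K = 0)).resolve_right hK
      rw [← hKx]
      linear_combination (ψ (shiftUp x) * h0 - ψ x * h1) *
        (uFun q a b c d x / ((1 - (q : ℂ)) * ((x : ℝ) : ℂ)))
    · refine (mul_eq_zero.1 (?_ : t * K = 0)).resolve_right hK
      rw [← hKx]
      linear_combination (φ x * h1 - φ (shiftUp x) * h0) *
        (uFun q a b c d x / ((1 - (q : ℂ)) * ((x : ℝ) : ℂ)))
  have hspan : ⊤ ≤ Submodule.span ℂ (Set.range v) := by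
    rintro ⟨f, hf⟩ -
    obtain ⟨K₁, h1⟩ := exists_casorati_eq hq0 hq1 hzp hzm h hc hd hf hψ
    obtain ⟨K₂, h2⟩ := exists_casorati_eq hq0 hq1 hzp hzm h hc hd hφ hf
    rw [hv, Matrix.range_cons_cons_empty, Submodule.mem_span_pair]
    refine ⟨K₁ / K, K₂ / K, Subtype.ext (funext fun x => ?_)⟩
    change K₁ / K * φ x + K₂ / K * ψ x = f x
    have := casorati_cramer a b c d f φ ψ x
    rw [hD, h1, h2] at this
    field_simp
    linear_combination -this
  refine ⟨Module.Basis.mk hli hspan, ?_, ?_⟩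
  · rw [Module.Basis.mk_apply]; rfl
  · rw [Module.Basis.mk_apply]; rfl

end Eigenspace

end BigQJacobi

end

theorem mainTheorem8 (q zp zm : ℝ) (hq0 : 0 < q) (hq1 : q < 1) (hzp : 0 < zp) (hzm : zm < 0)
    (a b c d : ℂ) (hP : (a, b, c, d) ∈ BigQJacobi.GenericDomain q zp zm)
    (γ : ℂ) (hγ : γ ≠ 0) :
    (∀ x : BigQJacobi.Rq q zp zm,
      BigQJacobi.casorati q zp zm a b c d
          (BigQJacobi.bigqJacobi q zp zm a b c d γ)
          (BigQJacobi.bigqJacobiDagger q zp zm a b c d γ) x =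
        (1 - (q : ℂ)) * (q : ℂ) / (a * BigQJacobi.sPar q a b c d) *
          (BigQJacobi.qPochInf q (BigQJacobi.sPar q a b c d * γ) *
              BigQJacobi.qPochInf q (BigQJacobi.sPar q a b c d / γ) *
              BigQJacobi.theta q (a / b) /
            (BigQJacobi.qPochInf q (c * (q : ℂ) / a) * BigQJacobi.qPochInf q (c * (q : ℂ) / b) *
              BigQJacobi.qPochInf q (d * (q : ℂ) / a) *
              BigQJacobi.qPochInf q (d * (q : ℂ) / b)))) ∧
    (γ ∉ BigQJacobi.Spol q a b c d →
      Module.finrank ℂ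
          (BigQJacobi.eigenspaceV q zp zm a b c d (BigQJacobi.eigenvalue γ)) = 2 ∧
      ∃ e : Module.Basis (Fin 2) ℂ
          (BigQJacobi.eigenspaceV q zp zm a b c d (BigQJacobi.eigenvalue γ)),
        (e 0 : BigQJacobi.Rq q zp zm → ℂ) = BigQJacobi.bigqJacobi q zp zm a b c d γ ∧
        (e 1 : BigQJacobi.Rq q zp zm → ℂ) = BigQJacobi.bigqJacobiDagger q zp zm a b c d γ) := by
  obtain ⟨a, b, c, d, he, ⟨a', b', c', d', he', hab, hcd, hne⟩, hne', hgen⟩ := hP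
  obtain ⟨rfl, rfl, rfl, rfl⟩ : _ ∧ _ ∧ _ ∧ _ := by simpa using he
  obtain ⟨rfl, rfl, rfl, rfl⟩ : _ ∧ _ ∧ _ ∧ _ := by simpa using he'
  have hreg := BigQJacobi.regular_of_pairDomain hq0 hzp hzm hab hcd hne hne'
    fun n => ⟨(hgen n).1, (hgen n).2.1, (hgen n).2.2.1, (hgen n).2.2.2.1⟩
  have hpt := fun {e : ℂ} => BigQJacobi.mul_coe_ne_one (q := q) (zp := zp) (zm := zm) (e := e)
  have hD := BigQJacobi.casorati_bigqJacobi hq0 hq1 hzp hzm hreg hγ (hpt hab.1) (hpt hab.2.1)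
    (hpt hcd.1) (hpt hcd.2.1)
  refine ⟨fun x => ?_, fun hS => ?_⟩
  · rw [hD x, BigQJacobi.casoratiFactor]
    ring
  · have hK := mul_ne_zero
      (div_ne_zero (mul_ne_zero (sub_ne_zero.2 (by exact_mod_cast hq1.ne' : (1 : ℂ) ≠ q))
        (by exact_mod_cast hq0.ne' : (q : ℂ) ≠ 0))
        (mul_ne_zero hreg.ha (BigQJacobi.sPar_ne_zero hq0 hreg)))
      (mul_ne_zero (BigQJacobi.theta_ne_zero hq0 hq1
        (BigQJacobi.PairDomain.div_ne_zpow hq0 hq1 hzp hzm hab hne))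
        (BigQJacobi.casoratiFactor_ne_zero hq0 hq1 hreg hγ hS))
    obtain ⟨e, he⟩ := BigQJacobi.exists_basis_of_casorati_ne_zero hq0 hq1 hzp hzm hreg
      (hpt hcd.1) (hpt hcd.2.1)
      (BigQJacobi.bigqJacobi_mem hq0 hq1 hzp hzm hreg hγ (hpt hab.1) (hpt hab.2.1))
      (BigQJacobi.bigqJacobiDagger_mem hq0 hq1 hzp hzm hreg hγ (hpt hab.1) (hpt hab.2.1)) hK hD
    exact ⟨by rw [Module.finrank_eq_card_basis e, Fintype.card_fin], e, he⟩
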